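/- Let $a>0$ and let $f_1,f_2\in L^1(\mathbb{R}^2)$ be complex-valued functions supported (almost everywhere) in the closed disk $\{x:|x|\le a/2\}$. Let $(f_1*f_2)(x)=\int_{\mathbb{R}^2}f_1(y)f_2(x-y)\,dy$. Let $m\in\mathbb{Z}$ and let $n\ge |m|$ be an integer with $n\equiv |m| \pmod 2$. Put $$Z_{nm}(r)=\sum_{j=0}^{(n-|m|)/2}(-1)^j\frac{(n-j)!}{j!\,\big(\frac{n+|m|}{2}-j\big)!\,\big(\frac{n-|m|}{2}-j\big)!}\,r^{n-2j},\qquad V^a_{nm}(r,\theta)=\frac1a\sqrt{\frac{n+1}{\pi}}\;Z_{nm}(r/a)\,e^{\mathrm{i}m\theta},$$ and, for a function $f$ on the plane, define its Fourier–Zernike coefficient and its Fourier coefficients on the square $[-a,a]^2$ by $$C^a_{n,m}(f)=\int_0^a\!\int_0^{2\pi}f(r\cos\theta,r\sin\theta)\,\overline{V^a_{nm}(r,\theta)}\;r\,d\theta\,dr,\qquad \widehat f(k)=\int_{-a}^a\!\int_{-a}^a f(x_1,x_2)\,e^{-\pi\mathrm{i}a^{-1}(k_1x_1+k_2x_2)}\,dx_1\,dx_2\quad(k\in\mathbb{Z}^2).$$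 For $k=(k_1,k_2)\in\mathbb{Z}^2$ let $|k|=\sqrt{k_1^2+k_2^2}$, let $\Phi(k)\in[0,2\pi)$ be the polar angle of $k$ (with $\Phi(0)=0$), let $J_q$ be the Bessel function of the first kind of order $q$, and put $$c_a(k;n,m)=\sqrt{n+1}\;\frac{\mathrm{i}^m(-1)^{\frac{n-m}{2}}J_{n+1}(\pi|k|)}{2a\sqrt{\pi}\,|k|}\;e^{-\mathrm{i}m\Phi(k)},$$ where for $k=0$ the quotient $J_{n+1}(\pi|k|)/|k|$ is replaced by its limit $\lim_{\rho\to0}J_{n+1}(\pi\rho)/\rho$, which is $\pi/2$ if $n=0$ and $0$ if $n\ge1$. Then $$C^a_{n,m}(f_1*f_2)=\sum_{k\in\mathbb{Z}^2}c_a(k;n,m)\,\widehat{f_1}(k)\,\widehat{f_2}(k),$$ where the series is the limit, as $N\to\infty$, of its square partial sums over $\{k:|k_1|\le N,\ |k_2|\le N\}$. If moreover $f_1*f_2\in L^2(\mathbb{R}^2)$ (in particular if $f_1$ or $f_2$ is in $L^2$), the series converges unconditionally (hence absolutely) to the same value. -/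

import Mathlib

/-- The closed disk of radius `r` about the origin of the Euclidean plane, written in coordinates
(the norm of `ℝ × ℝ` in Mathlib is the sup norm). -/
def disk (r : ℝ) : Set (ℝ × ℝ) := {x | x.1 ^ 2 + x.2 ^ 2 ≤ r ^ 2}

/-- Convolution on the plane: `(f₁ ∗ f₂)(x) = ∫ f₁(y) f₂(x - y) dy`, for Lebesgue measure. -/
noncomputable def planeConv (f₁ f₂ : ℝ × ℝ → ℂ) : ℝ × ℝ → ℂ :=
  MeasureTheory.convolution f₁ f₂ (ContinuousLinearMap.mul ℝ ℂ) MeasureTheory.volume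

/-- The Bessel function of the first kind `J_q` of integer order `q ≥ 0`. -/
noncomputable def besselJ (q : ℕ) (x : ℝ) : ℝ :=
  ∑' j : ℕ, (-1 : ℝ) ^ j / ((j.factorial : ℝ) * ((j + q).factorial : ℝ)) * (x / 2) ^ (2 * j + q)

/-- The radial Zernike polynomial `Z_{nm}`, for `|m| ≤ n` and `n - |m|` even. -/
noncomputable def zernikeRadial (n : ℕ) (m : ℤ) (r : ℝ) : ℝ :=
  ∑ j ∈ Finset.range ((n - m.natAbs) / 2 + 1),
    (-1 : ℝ) ^ j *
      (((n - j).factorial : ℝ) /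
        ((j.factorial : ℝ) * (((n + m.natAbs) / 2 - j).factorial : ℝ) *
          (((n - m.natAbs) / 2 - j).factorial : ℝ))) *
      r ^ (n - 2 * j)

/-- The Fourier–Zernike basis element `V_{nm}^a` in polar coordinates. -/
noncomputable def fourierZernike (a : ℝ) (n : ℕ) (m : ℤ) (r θ : ℝ) : ℂ :=
  ((a⁻¹ * Real.sqrt (((n : ℝ) + 1) / Real.pi) * zernikeRadial n m (a⁻¹ * r) : ℝ) : ℂ) *
    Complex.exp (Complex.I * (m : ℂ) * (θ : ℂ))

/-- The Fourier–Zernike coefficient `C_{n,m}^a(f)`. -/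
noncomputable def zernikeCoeff (a : ℝ) (n : ℕ) (m : ℤ) (f : ℝ × ℝ → ℂ) : ℂ :=
  ∫ r in (0 : ℝ)..a, ∫ θ in (0 : ℝ)..(2 * Real.pi),
    f (r * Real.cos θ, r * Real.sin θ) * starRingEnd ℂ (fourierZernike a n m r θ) * (r : ℂ)

/-- The (unnormalized) Fourier coefficient of `f` on the square `[-a, a]²`. -/
noncomputable def squareFourierCoeff (a : ℝ) (f : ℝ × ℝ → ℂ) (k : ℤ × ℤ) : ℂ :=
  ∫ x₂ in (-a)..a, ∫ x₁ in (-a)..a,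
    f (x₁, x₂) *
      Complex.exp (-((Real.pi : ℂ) * Complex.I * (a : ℂ)⁻¹ *
        ((k.1 : ℂ) * (x₁ : ℂ) + (k.2 : ℂ) * (x₂ : ℂ))))

/-- The Euclidean length `|k|`. -/
noncomputable def latticeNorm (k : ℤ × ℤ) : ℝ := Real.sqrt ((k.1 : ℝ) ^ 2 + (k.2 : ℝ) ^ 2)

/-- The polar angle `Φ(k) ∈ [0, 2π)` of `k` (with `Φ(0) = 0`). -/
noncomputable def latticeAngle (k : ℤ × ℤ) : ℝ :=
  toIcoMod Real.two_pi_pos 0 (Complex.arg ⟨(k.1 : ℝ), (k.2 : ℝ)⟩)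

/-- `J_{n+1}(πρ) / ρ`, continuously extended to `ρ = 0`: there the value is `π / 2` for `n = 0`
and `0` for `n ≥ 1`. -/
noncomputable def besselQuotient (n : ℕ) (ρ : ℝ) : ℝ :=
  if ρ = 0 then (if n = 0 then Real.pi / 2 else 0) else besselJ (n + 1) (Real.pi * ρ) / ρ

/-- The factor `c_a(k; n, m)`. In the exponent, `n - m` is even, so the division is exact. -/
noncomputable def convFactor (a : ℝ) (k : ℤ × ℤ) (n : ℕ) (m : ℤ) : ℂ :=
  (Real.sqrt ((n : ℝ) + 1) : ℂ) *
    (Complex.I ^ m * (-1 : ℂ) ^ (((n : ℤ) - m) / 2) * (besselQuotient n (latticeNorm k) : ℂ) /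
      (2 * (a : ℂ) * (Real.sqrt Real.pi : ℂ))) *
    Complex.exp (-(Complex.I * (m : ℂ) * (latticeAngle k : ℂ)))

/-- The lattice points of the square `[-N, N]²`. -/
noncomputable def latticeSquare (N : ℕ) : Finset (ℤ × ℤ) :=
  Finset.Icc (-(N : ℤ)) (N : ℤ) ×ˢ Finset.Icc (-(N : ℤ)) (N : ℤ)

open Real Set MeasureTheory intervalIntegral

/-!
By the Jacobi–Anger expansion and the Hankel transform of the Zernike polynomials, the conjugate
of `V_{nm}^a`, cut off to the disk of radius `a`, has on the square `[-a, a]²` the Fourier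
coefficients `4a² c_a(k; n, m)`, up to the sign of `k`. Since `f₁ ∗ f₂` is supported in the square,
the convolution theorem makes `f̂₁ f̂₂` its Fourier coefficients, so the `N`-th square partial sum
of the series is the integral of `f₁ ∗ f₂` against the square partial sum `S_N` of the cut-off
function.

The pairing of `S_N` with a trigonometric polynomial is eventually exact, and these are dense in
`L¹`, so it suffices that the `S_N` are uniformly bounded on the square. Now `S_N` is the integral
of a polynomial against a product of two translated Dirichlet kernels over a disk, which is cut
into pieces bounded by graphs of slope at most `1`. Integrating by parts in one variable replaces
one kernel by its primitive, which is within `O(1/√N)` in `L²` of a step of height `π`; this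
compensates `‖D_N‖₂ = O(√N)`.

If `f₁ ∗ f₂` is square integrable, Bessel's inequality makes both factors of the terms square
summable.
-/

/-! ### The Dirichlet kernel and its primitive -/

section IntegrationByParts

variable {a b M : ℝ} {q q' φ φ' : ℝ → ℝ}

theorem abs_integral_mul_deriv_le_add (hab : a ≤ b) (hq : ∀ v ∈ Icc a b, HasDerivAt q (q' v) v)
    (hφ : ∀ v ∈ Icc a b, HasDerivAt φ (φ' v) v) (hq' : ContinuousOn q' (Icc a b))
    (hφ' : ContinuousOn φ' (Icc a b)) (hM : ∀ v ∈ Icc a b, |φ v| ≤ M) :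
    |∫ v in a..b, q v * φ' v| ≤ M * (|q a| + |q b|) + |∫ v in a..b, q' v * φ v| := by
  have hu : uIcc a b = Icc a b := uIcc_of_le hab
  have hboundary : ∀ v ∈ Icc a b, |q v * φ v| ≤ M * |q v| := fun v hv => by
    rw [abs_mul, mul_comm]; gcongr; exact hM v hv
  rw [integral_mul_deriv_eq_deriv_mul (hu ▸ hq) (hu ▸ hφ) (hq'.intervalIntegrable_of_Icc hab)
    (hφ'.intervalIntegrable_of_Icc hab)]
  calc |q b * φ b - q a * φ a - ∫ v in a..b, q' v * φ v|
      ≤ |q b * φ b| + |q a * φ a| + |∫ v in a..b, q' v * φ v| :=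
        (abs_sub _ _).trans (by gcongr; exact abs_sub _ _)
    _ ≤ M * |q b| + M * |q a| + |∫ v in a..b, q' v * φ v| := by
        gcongr
        exacts [hboundary b (right_mem_Icc.2 hab), hboundary a (left_mem_Icc.2 hab)]
    _ = M * (|q a| + |q b|) + |∫ v in a..b, q' v * φ v| := by ring

theorem abs_integral_mul_deriv_le (hab : a ≤ b) (hq : ∀ v ∈ Icc a b, HasDerivAt q (q' v) v)
    (hφ : ∀ v ∈ Icc a b, HasDerivAt φ (φ' v) v) (hq' : ContinuousOn q' (Icc a b))
    (hφ' : ContinuousOn φ' (Icc a b)) (hM : ∀ v ∈ Icc a b, |φ v| ≤ M) :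
    |∫ v in a..b, q v * φ' v| ≤ M * (|q a| + |q b| + ∫ v in a..b, |q' v|) := by
  have hinterior : |∫ v in a..b, q' v * φ v| ≤ M * ∫ v in a..b, |q' v| := by
    rw [← intervalIntegral.integral_const_mul, ← norm_eq_abs]
    refine norm_integral_le_of_norm_le hab (ae_of_all _ fun v hv => ?_)
      ((continuousOn_const.mul hq'.abs).intervalIntegrable_of_Icc hab)
    rw [norm_mul, mul_comm]
    exact mul_le_mul_of_nonneg_right (hM v (Ioc_subset_Icc_self hv)) (norm_nonneg _)
  linarith [abs_integral_mul_deriv_le_add hab hq hφ hq' hφ' hM]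

theorem abs_integral_mul_deriv_le_of_bounded {A B : ℝ} (hab : a ≤ b)
    (hq : ∀ v ∈ Icc a b, HasDerivAt q (q' v) v)
    (hφ : ∀ v ∈ Icc a b, HasDerivAt φ (φ' v) v) (hq' : ContinuousOn q' (Icc a b))
    (hφ' : ContinuousOn φ' (Icc a b)) (hM : ∀ v ∈ Icc a b, |φ v| ≤ M)
    (hA : ∀ v ∈ Icc a b, |q v| ≤ A) (hB : ∀ v ∈ Icc a b, |q' v| ≤ B) :
    |∫ v in a..b, q v * φ' v| ≤ M * (2 * A + B * (b - a)) := by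
  have ha := left_mem_Icc.2 hab
  have hM0 : 0 ≤ M := (abs_nonneg _).trans (hM a ha)
  have hint : ∫ v in a..b, |q' v| ≤ B * (b - a) := by
    simpa [mul_comm] using integral_mono_on hab (hq'.abs.intervalIntegrable_of_Icc hab)
      (continuous_const (y := B) |>.intervalIntegrable (μ := volume) _ _) hB
  refine (abs_integral_mul_deriv_le hab hq hφ hq' hφ' hM).trans ?_
  gcongr
  linarith [hA a ha, hA b (right_mem_Icc.2 hab)]

theorem abs_integral_mul_deriv_le_of_deriv_nonpos (hab : a ≤ b)
    (hq : ∀ v ∈ Icc a b, HasDerivAt q (q' v) v)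
    (hφ : ∀ v ∈ Icc a b, HasDerivAt φ (φ' v) v) (hq' : ContinuousOn q' (Icc a b))
    (hφ' : ContinuousOn φ' (Icc a b)) (hM : ∀ v ∈ Icc a b, |φ v| ≤ M)
    (hneg : ∀ v ∈ Icc a b, q' v ≤ 0) (hqb : 0 ≤ q b) :
    |∫ v in a..b, q v * φ' v| ≤ M * (2 * q a) := by
  have hu : uIcc a b = Icc a b := uIcc_of_le hab
  have hint : ∫ v in a..b, |q' v| = q a - q b := by
    rw [integral_congr fun v hv => abs_of_nonpos (hneg v (hu ▸ hv)),
      intervalIntegral.integral_neg,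
      integral_eq_sub_of_hasDerivAt (hu ▸ hq) (hq'.intervalIntegrable_of_Icc hab), neg_sub]
  have hqa : q b ≤ q a := by
    have : 0 ≤ ∫ v in a..b, |q' v| := integral_nonneg hab fun v _ => abs_nonneg _
    linarith
  refine (abs_integral_mul_deriv_le hab hq hφ hq' hφ' hM).trans_eq ?_
  rw [hint, abs_of_nonneg hqb, abs_of_nonneg (hqb.trans hqa)]
  ring

end IntegrationByParts

/-- The Dirichlet kernel `1 + 2 ∑_{k=1}^N cos (k t)`, the multiplier of the `N`-th symmetric partial
sum of a Fourier series. -/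
noncomputable def dirichletKernel (N : ℕ) (t : ℝ) : ℝ :=
  1 + 2 * ∑ k ∈ Finset.range N, cos ((k + 1 : ℝ) * t)

/-- The primitive of the Dirichlet kernel that vanishes at `0`. As `N → ∞` it approaches `π` on
`(0, 2π)` and `-π` on `(-2π, 0)`. -/
noncomputable def dirichletPrimitive (N : ℕ) (t : ℝ) : ℝ :=
  t + 2 * ∑ k ∈ Finset.range N, sin ((k + 1 : ℝ) * t) / (k + 1)

section DirichletKernel

variable (N : ℕ) {t : ℝ}

theorem continuous_dirichletKernel : Continuous (dirichletKernel N) := by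
  unfold dirichletKernel; fun_prop

theorem dirichletKernel_succ (t : ℝ) :
    dirichletKernel (N + 1) t = dirichletKernel N t + 2 * cos ((N + 1 : ℝ) * t) := by
  simp only [dirichletKernel, Finset.sum_range_succ]; ring

theorem hasDerivAt_dirichletPrimitive (t : ℝ) :
    HasDerivAt (dirichletPrimitive N) (dirichletKernel N t) t := by
  unfold dirichletPrimitive dirichletKernel
  refine (hasDerivAt_id t).add (HasDerivAt.const_mul 2 (HasDerivAt.fun_sum fun k _ => ?_))
  have hk : (k + 1 : ℝ) ≠ 0 := by positivity
  have h := ((hasDerivAt_id t).const_mul (k + 1 : ℝ)).sin.div_const (k + 1 : ℝ)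
  refine h.congr_deriv ?_
  simp only [id]
  field_simp

theorem continuous_dirichletPrimitive : Continuous (dirichletPrimitive N) :=
  continuous_iff_continuousAt.2 fun t => (hasDerivAt_dirichletPrimitive N t).continuousAt

theorem dirichletKernel_neg (t : ℝ) : dirichletKernel N (-t) = dirichletKernel N t := by
  simp [dirichletKernel]

theorem dirichletPrimitive_neg (t : ℝ) :
    dirichletPrimitive N (-t) = -dirichletPrimitive N t := by
  simp only [dirichletPrimitive, mul_neg, sin_neg, neg_div, Finset.sum_neg_distrib]
  ring

theorem dirichletPrimitive_two_pi_sub (t : ℝ) :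
    dirichletPrimitive N (2 * π - t) = 2 * π - dirichletPrimitive N t := by
  have h : ∀ k : ℕ, sin ((k + 1 : ℝ) * (2 * π - t)) = -sin ((k + 1 : ℝ) * t) := fun k => by
    have := sin_nat_mul_two_pi_sub ((k + 1 : ℝ) * t) (k + 1)
    rw [← this]; push_cast; ring_nf
  simp only [dirichletPrimitive, h, neg_div, Finset.sum_neg_distrib]
  ring

theorem dirichletPrimitive_pi : dirichletPrimitive N π = π := by
  have h : ∀ k : ℕ, sin ((k + 1 : ℝ) * π) = 0 := fun k => by
    exact_mod_cast sin_nat_mul_pi (k + 1)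
  simp [dirichletPrimitive, h]

theorem dirichletKernel_mul_sin (t : ℝ) :
    dirichletKernel N t * sin (t / 2) = sin ((N + 1 / 2 : ℝ) * t) := by
  induction N with
  | zero =>
    simp only [dirichletKernel, Finset.range_zero, Finset.sum_empty, Nat.cast_zero]
    ring_nf
  | succ N ih =>
    have hsub : ((N : ℝ) + 1 / 2) * t = (N + 1 : ℝ) * t - t / 2 := by ring
    have hadd : (((N + 1 : ℕ) : ℝ) + 1 / 2) * t = (N + 1 : ℝ) * t + t / 2 := by push_cast; ring
    rw [dirichletKernel_succ, add_mul, ih, hsub, hadd, sin_sub, sin_add]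
    ring

theorem abs_dirichletPrimitive_le_mul (ht : 0 ≤ t) :
    |dirichletPrimitive N t| ≤ (2 * N + 1) * t := by
  have h : |∑ k ∈ Finset.range N, sin ((k + 1 : ℝ) * t) / (k + 1)| ≤ N * t := by
    refine (Finset.abs_sum_le_sum_abs _ _).trans ?_
    refine (Finset.sum_le_sum (g := fun _ => t) fun k _ => ?_).trans_eq (by simp)
    have hk : (0 : ℝ) < k + 1 := by positivity
    rw [abs_div, abs_of_pos hk, div_le_iff₀ hk]
    refine abs_sin_le_abs.trans_eq ?_
    rw [abs_of_nonneg (by positivity), mul_comm]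
  refine (abs_add_le _ _).trans ?_
  rw [abs_mul, abs_of_nonneg ht, abs_two]
  linarith

theorem abs_integral_sin_mul_div_sin_le {l : ℝ} (hl : 0 < l) (ht : 0 < t) (htπ : t ≤ π) :
    |∫ s in t..π, (sin (s / 2))⁻¹ * sin (l * s)| ≤ l⁻¹ * (2 * (sin (t / 2))⁻¹) := by
  have hsin : ∀ s ∈ Icc t π, 0 < sin (s / 2) := fun s hs =>
    sin_pos_of_pos_of_lt_pi (by linarith [hs.1]) (by linarith [hs.2, pi_pos])
  have hcos : ∀ s ∈ Icc t π, 0 ≤ cos (s / 2) := fun s hs =>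
    cos_nonneg_of_neg_pi_div_two_le_of_le (by linarith [hs.1, pi_pos]) (by linarith [hs.2])
  refine abs_integral_mul_deriv_le_of_deriv_nonpos (φ := fun s => -(l⁻¹ * cos (l * s)))
    (q' := fun s => -(cos (s / 2) / (2 * sin (s / 2) ^ 2))) htπ
    (fun s hs => ?_) (fun s _ => ?_) ?_ (by fun_prop) (fun s _ => ?_) (fun s hs => ?_) (by simp)
  · refine ((hasDerivAt_id s).div_const 2).sin.inv (hsin s hs).ne' |>.congr_deriv ?_
    simp only [id]
    field_simp
  · refine (((hasDerivAt_id s).const_mul l).cos.const_mul l⁻¹).neg.congr_deriv ?_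
    simp only [id]
    field_simp
  · refine (ContinuousOn.div (by fun_prop) (by fun_prop) fun s hs => ?_).neg
    have := hsin s hs
    positivity
  · rw [abs_neg, abs_mul, abs_of_pos (inv_pos.2 hl)]
    exact mul_le_of_le_one_right (inv_pos.2 hl).le (abs_cos_le_one _)
  · exact neg_nonpos.2 (div_nonneg (hcos s hs) (by positivity))

theorem abs_dirichletPrimitive_sub_pi_le (ht : 0 < t) (htπ : t ≤ π) :
    |dirichletPrimitive N t - π| ≤ 4 / ((2 * N + 1) * sin (t / 2)) := by
  have hkernel : ∀ s ∈ uIcc t π,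
      dirichletKernel N s = (sin (s / 2))⁻¹ * sin ((N + 1 / 2 : ℝ) * s) := fun s hs => by
    rw [uIcc_of_le htπ] at hs
    have : 0 < sin (s / 2) :=
      sin_pos_of_pos_of_lt_pi (by linarith [hs.1]) (by linarith [hs.2, pi_pos])
    rw [← dirichletKernel_mul_sin]
    field_simp
  have htail : π - dirichletPrimitive N t
      = ∫ s in t..π, (sin (s / 2))⁻¹ * sin ((N + 1 / 2 : ℝ) * s) := by
    rw [← integral_congr hkernel, integral_eq_sub_of_hasDerivAt
      (fun s _ => hasDerivAt_dirichletPrimitive N s)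
      ((continuous_dirichletKernel N).intervalIntegrable _ _), dirichletPrimitive_pi]
  rw [abs_sub_comm, htail]
  refine (abs_integral_sin_mul_div_sin_le (by positivity) ht htπ).trans_eq ?_
  field_simp
  ring

theorem mul_abs_dirichletPrimitive_sub_pi_le (ht : 0 < t) (htπ : t ≤ π) :
    (2 * N + 1) * t * |dirichletPrimitive N t - π| ≤ 4 * π := by
  have hs : t / π ≤ sin (t / 2) := by
    have := mul_le_sin (x := t / 2) (by linarith) (by linarith)
    calc t / π = 2 / π * (t / 2) := by ring
      _ ≤ _ := this
  have hs0 : 0 < sin (t / 2) := lt_of_lt_of_le (by positivity) hs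
  have h := abs_dirichletPrimitive_sub_pi_le N ht htπ
  have hL : (0 : ℝ) < 2 * N + 1 := by positivity
  calc (2 * N + 1) * t * |dirichletPrimitive N t - π|
      ≤ (2 * N + 1) * t * (4 / ((2 * N + 1) * sin (t / 2))) := by gcongr
    _ = 4 * (t / sin (t / 2)) := by field_simp
    _ ≤ 4 * π := by
      gcongr
      rw [div_le_iff₀ hs0]
      rw [div_le_iff₀ pi_pos] at hs
      linarith

theorem abs_dirichletPrimitive_two_pi_sub_sub_pi (t : ℝ) :
    |dirichletPrimitive N (2 * π - t) - π| = |dirichletPrimitive N t - π| := by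
  rw [dirichletPrimitive_two_pi_sub, ← abs_neg]
  congr 1
  ring

theorem abs_dirichletPrimitive_sub_pi_le_four_pi (ht : 0 ≤ t) (ht2 : t ≤ 2 * π) :
    |dirichletPrimitive N t - π| ≤ 4 * π := by
  wlog h : t ≤ π generalizing t
  · rw [← abs_dirichletPrimitive_two_pi_sub_sub_pi]
    exact this (by linarith) (by linarith) (by linarith)
  rcases le_total ((2 * N + 1) * t) 1 with hLt | hLt
  · have hprimitive := (abs_dirichletPrimitive_le_mul N ht).trans hLt
    have htriangle := abs_sub (dirichletPrimitive N t) π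
    rw [abs_of_pos pi_pos] at htriangle
    linarith [pi_gt_three]
  · have ht0 : 0 < t := ht.lt_of_ne fun hzero => by norm_num [← hzero] at hLt
    exact (le_mul_of_one_le_left (abs_nonneg _) hLt).trans
      (mul_abs_dirichletPrimitive_sub_pi_le N ht0 h)

theorem abs_dirichletPrimitive_le (ht : |t| ≤ 2 * π) : |dirichletPrimitive N t| ≤ 5 * π := by
  wlog h : 0 ≤ t generalizing t
  · rw [← abs_neg, ← dirichletPrimitive_neg]
    exact this (by rwa [abs_neg]) (by linarith)
  have := abs_dirichletPrimitive_sub_pi_le_four_pi N h (le_of_abs_le ht)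
  rw [abs_le] at this ⊢
  constructor <;> linarith [this.1, this.2, pi_pos]

theorem mul_abs_dirichletPrimitive_sub_pi_le_of_le (ht : 0 ≤ t) (ht2 : t ≤ 7 * π / 4) :
    (2 * N + 1) * t * |dirichletPrimitive N t - π| ≤ 28 * π := by
  rcases ht.eq_or_lt with rfl | ht0
  · simp only [mul_zero, zero_mul]; positivity
  rcases le_total t π with h | h
  · linarith [mul_abs_dirichletPrimitive_sub_pi_le N ht0 h, pi_pos]
  · have hreflect := mul_abs_dirichletPrimitive_sub_pi_le N (t := 2 * π - t)
      (by linarith [pi_pos]) (by linarith)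
    rw [abs_dirichletPrimitive_two_pi_sub_sub_pi] at hreflect
    have hcompare : t ≤ 7 * (2 * π - t) := by linarith
    calc (2 * N + 1) * t * |dirichletPrimitive N t - π|
        ≤ (2 * N + 1) * (7 * (2 * π - t)) * |dirichletPrimitive N t - π| := by gcongr
      _ = 7 * ((2 * N + 1) * (2 * π - t) * |dirichletPrimitive N t - π|) := by ring
      _ ≤ 7 * (4 * π) := by gcongr
      _ = 28 * π := by ring

theorem sq_dirichletPrimitive_sub_pi_le (ht : 0 ≤ t) (ht2 : t ≤ 7 * π / 4) :
    (dirichletPrimitive N t - π) ^ 2 ≤ 800 * π ^ 2 / (1 + ((2 * N + 1) * t) ^ 2) := by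
  have hbounded := pow_le_pow_left₀ (abs_nonneg _)
    (abs_dirichletPrimitive_sub_pi_le_four_pi N ht (by linarith [pi_pos])) 2
  have hdecay := pow_le_pow_left₀ (by positivity)
    (mul_abs_dirichletPrimitive_sub_pi_le_of_le N ht ht2) 2
  rw [le_div_iff₀ (by positivity)]
  rw [mul_pow, sq_abs] at hdecay
  rw [sq_abs] at hbounded
  linarith

theorem sq_dirichletPrimitive_add_pi_le (ht : t ≤ 0) (ht2 : -(7 * π / 4) ≤ t) :
    (dirichletPrimitive N t + π) ^ 2 ≤ 800 * π ^ 2 / (1 + ((2 * N + 1) * t) ^ 2) := by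
  convert sq_dirichletPrimitive_sub_pi_le N (t := -t) (by linarith) (by linarith) using 1
  · rw [dirichletPrimitive_neg]; ring
  · ring

theorem integral_exp_int_mul (k : ℤ) (c : ℝ) :
    ∫ t in c..(c + 2 * π), Complex.exp (Complex.I * k * t) = if k = 0 then (2 * π : ℂ) else 0 := by
  split_ifs with hk
  · simp [hk]
  · have hfreq : Complex.I * k ≠ 0 := mul_ne_zero Complex.I_ne_zero (by exact_mod_cast hk)
    have hperiod : Complex.I * k * ((c + 2 * π : ℝ) : ℂ)
        = Complex.I * k * c + k * (2 * π * Complex.I) := by push_cast; ring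
    rw [integral_exp_mul_complex hfreq, hperiod, Complex.exp_add, Complex.exp_int_mul_two_pi_mul_I]
    simp

theorem dirichletKernel_eq_sum_exp (t : ℝ) :
    (dirichletKernel N t : ℂ) = ∑ k ∈ Finset.Icc (-(N : ℤ)) N, Complex.exp (Complex.I * k * t) := by
  induction N with
  | zero => simp [dirichletKernel]
  | succ N ih =>
    have hI : Finset.Icc (-((N + 1 : ℕ) : ℤ)) ((N + 1 : ℕ) : ℤ)
        = insert (-((N + 1 : ℕ) : ℤ)) (insert ((N + 1 : ℕ) : ℤ) (Finset.Icc (-(N : ℤ)) N)) := by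
      ext k; simp only [Finset.mem_Icc, Finset.mem_insert]; push_cast; lia
    rw [hI, Finset.sum_insert, Finset.sum_insert, ← ih, dirichletKernel_succ]
    · push_cast
      rw [Complex.cos]
      ring_nf
    · simp
    · simp only [Finset.mem_Icc, Finset.mem_insert]; push_cast; lia

variable {N} in
theorem integral_exp_int_mul_dirichletKernel {k : ℤ} (hk : k ∈ Finset.Icc (-(N : ℤ)) N) (c : ℝ) :
    ∫ t in c..(c + 2 * π), Complex.exp (Complex.I * k * t) * dirichletKernel N t = 2 * π := by
  have hexpand : ∀ t : ℝ, Complex.exp (Complex.I * k * t) * dirichletKernel N t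
      = ∑ l ∈ Finset.Icc (-(N : ℤ)) N, Complex.exp (Complex.I * ((k + l : ℤ) : ℂ) * t) := by
    intro t
    rw [dirichletKernel_eq_sum_exp, Finset.mul_sum]
    refine Finset.sum_congr rfl fun l _ => ?_
    rw [← Complex.exp_add]; push_cast; ring_nf
  simp_rw [hexpand]
  rw [intervalIntegral.integral_finsetSum
    fun l _ => Continuous.intervalIntegrable (by fun_prop) _ _]
  simp_rw [integral_exp_int_mul]
  rw [Finset.sum_eq_single (-k) (fun l _ hl => if_neg (by lia))
    fun hk' => by simp only [Finset.mem_Icc] at hk hk'; lia]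
  simp

theorem integral_dirichletKernel_sq (c : ℝ) :
    ∫ t in c..(c + 2 * π), dirichletKernel N t ^ 2 = 2 * π * (2 * N + 1) := by
  have hexpand : ∀ t : ℝ, ((dirichletKernel N t ^ 2 : ℝ) : ℂ) = ∑ k ∈ Finset.Icc (-(N : ℤ)) N,
      Complex.exp (Complex.I * k * t) * dirichletKernel N t := by
    intro t
    rw [← Finset.sum_mul, ← dirichletKernel_eq_sum_exp]
    push_cast
    ring
  have hcomplex : ∫ t in c..(c + 2 * π), ((dirichletKernel N t ^ 2 : ℝ) : ℂ)
      = ((2 * π * (2 * N + 1) : ℝ) : ℂ) := by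
    have hcont := continuous_dirichletKernel N
    simp_rw [hexpand]
    rw [intervalIntegral.integral_finsetSum
      fun k _ => Continuous.intervalIntegrable (by fun_prop) _ _,
      Finset.sum_congr rfl fun k hk => integral_exp_int_mul_dirichletKernel hk c]
    have hcard : ((N : ℤ) + 1 - -(N : ℤ)).toNat = 2 * N + 1 := by lia
    simp only [Finset.sum_const, Int.card_Icc, nsmul_eq_mul, hcard]
    push_cast; ring
  rw [intervalIntegral.integral_ofReal] at hcomplex
  exact_mod_cast hcomplex

end DirichletKernel

/-! ### Double integrals of the Dirichlet kernel under a graph -/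

/-- `h` is, over `s`, a `C¹` function with values in `[0, π]` whose slope lies in `[-1, 0]`: the
upper boundary curve of a region over which a product of two Dirichlet kernels is integrated. The
lower bound on the slope lets the mean square of `dirichletKernel N (y - h u)` with weight `|h' u|`
control the one with weight `(h' u)²`. -/
structure IsBoundaryProfile (h : ℝ → ℝ) (s : Set ℝ) : Prop where
  differentiableAt : ∀ u ∈ s, DifferentiableAt ℝ h u
  continuousOn_deriv : ContinuousOn (deriv h) s
  deriv_mem : ∀ u ∈ s, deriv h u ∈ Icc (-1) 0
  mapsTo : MapsTo h s (Icc 0 π)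

namespace IsBoundaryProfile

variable {h : ℝ → ℝ} {s t : Set ℝ}

theorem mono (H : IsBoundaryProfile h s) (hts : t ⊆ s) : IsBoundaryProfile h t :=
  ⟨fun u hu => H.differentiableAt u (hts hu), H.continuousOn_deriv.mono hts,
    fun u hu => H.deriv_mem u (hts hu), H.mapsTo.mono_left hts⟩

theorem continuousOn (H : IsBoundaryProfile h s) : ContinuousOn h s := fun u hu =>
  (H.differentiableAt u hu).continuousAt.continuousWithinAt

theorem abs_deriv_le_one (H : IsBoundaryProfile h s) {u : ℝ} (hu : u ∈ s) : |deriv h u| ≤ 1 :=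
  abs_le.2 ⟨(H.deriv_mem u hu).1, (H.deriv_mem u hu).2.trans zero_le_one⟩

variable (N : ℕ) (y : ℝ)

theorem continuousOn_dirichletKernel_comp (H : IsBoundaryProfile h s) :
    ContinuousOn (fun u => dirichletKernel N (y - h u)) s :=
  (continuous_dirichletKernel N).comp_continuousOn (continuousOn_const.sub H.continuousOn)

theorem continuousOn_dirichletKernel_comp_mul_deriv (H : IsBoundaryProfile h s) :
    ContinuousOn (fun u => dirichletKernel N (y - h u) * deriv h u) s :=
  (H.continuousOn_dirichletKernel_comp N y).mul H.continuousOn_deriv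

theorem integral_dirichletKernel_sq_le {α β : ℝ} (H : IsBoundaryProfile h (Icc α β))
    (hαβ : α ≤ β) :
    ∫ u in α..β, dirichletKernel N (y - h u) ^ 2 * -deriv h u ≤ 2 * π * (2 * N + 1) := by
  have hα := left_mem_Icc.2 hαβ
  have hβ := right_mem_Icc.2 hαβ
  have hu : uIcc α β = Icc α β := uIcc_of_le hαβ
  have hcont : Continuous fun t => dirichletKernel N t ^ 2 := (continuous_dirichletKernel N).pow 2
  have hsubst := integral_comp_mul_deriv (f := fun u => y - h u)
    (g := fun t => dirichletKernel N t ^ 2)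
    (fun u hu' => (H.differentiableAt u (hu ▸ hu')).hasDerivAt.const_sub y)
    (hu ▸ H.continuousOn_deriv.neg) hcont
  have hanti : h β ≤ h α :=
    antitoneOn_of_deriv_nonpos (convex_Icc α β) H.continuousOn
      (fun u hu => (H.differentiableAt u (interior_subset hu)).differentiableWithinAt)
      (fun u hu => (H.deriv_mem u (interior_subset hu)).2) hα hβ hαβ
  simp only [Function.comp_def] at hsubst
  rw [hsubst, ← integral_dirichletKernel_sq N (y - h α)]
  exact integral_mono_interval le_rfl (by linarith)
    (by linarith [(H.mapsTo hα).2, (H.mapsTo hβ).1, pi_pos])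
    (Filter.Eventually.of_forall fun t => sq_nonneg _) (hcont.intervalIntegrable _ _)

end IsBoundaryProfile

theorem integral_div_one_add_sq_le {L : ℝ} (α β x : ℝ) :
    ∫ u in α..β, L / (1 + (L * (x - u)) ^ 2) ≤ π := by
  have hd : ∀ u ∈ uIcc α β, HasDerivAt (fun u => -arctan (L * (x - u)))
      (L / (1 + (L * (x - u)) ^ 2)) u := fun u _ => by
    refine (((hasDerivAt_id u).const_sub x).const_mul L).arctan.neg.congr_deriv ?_
    simp [div_eq_inv_mul]
  rw [integral_eq_sub_of_hasDerivAt hd (Continuous.intervalIntegrable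
    (continuous_const.div (by fun_prop) fun u => by positivity) _ _)]
  linarith [arctan_lt_pi_div_two (L * (x - α)), neg_pi_div_two_lt_arctan (L * (x - β))]

section DirichletKernelAlongProfile

variable (N : ℕ) {α β σ x y A B K : ℝ} {h q q' : ℝ → ℝ}

theorem hasDerivAt_neg_dirichletPrimitive_sub (x u : ℝ) :
    HasDerivAt (fun u => -dirichletPrimitive N (x - u)) (dirichletKernel N (x - u)) u := by
  refine ((hasDerivAt_dirichletPrimitive N (x - u)).comp u
    ((hasDerivAt_id u).const_sub x)).neg.congr_deriv ?_
  ring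

theorem abs_integral_mul_dirichletKernel_comp_le (H : IsBoundaryProfile h (Icc α β)) (hαβ : α ≤ β)
    (hy : |y| ≤ π) (hq : ∀ v ∈ Icc α β, HasDerivAt q (q' v) v)
    (hq' : ContinuousOn q' (Icc α β)) (hA : ∀ v ∈ Icc α β, |q v| ≤ A)
    (hB : ∀ v ∈ Icc α β, |q' v| ≤ B) :
    |∫ v in α..β, q v * (dirichletKernel N (y - h v) * deriv h v)|
      ≤ 5 * π * (2 * A + B * (β - α)) := by
  refine abs_integral_mul_deriv_le_of_bounded hαβ hq
    (φ := fun v => -dirichletPrimitive N (y - h v)) (fun v hv => ?_) hq'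
    (H.continuousOn_dirichletKernel_comp_mul_deriv N y) (fun v hv => ?_) hA hB
  · exact (hasDerivAt_neg_dirichletPrimitive_sub N y (h v)).comp v
      (H.differentiableAt v hv).hasDerivAt
  · rw [abs_neg]
    refine abs_dirichletPrimitive_le N (abs_le.2 ?_)
    have := abs_le.1 hy
    have := H.mapsTo hv
    constructor <;> linarith [this.1, this.2, pi_pos]

theorem abs_mul_slope_le {L e D p s E : ℝ} (hL : 0 < L) (hp : |p| ≤ A) (he : e ^ 2 ≤ E)
    (hs : s ∈ Icc (-1) 0) :
    |e * (p * (D * s))| ≤ A * (L * E) + A * L⁻¹ * (D ^ 2 * -s) := by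
  have hyoung : |e| * |D| ≤ L * e ^ 2 + L⁻¹ * D ^ 2 := by
    have := two_mul_le_add_mul_sq (a := |e|) (b := |D|) hL
    rw [sq_abs, sq_abs] at this
    nlinarith [mul_nonneg (abs_nonneg e) (abs_nonneg D)]
  have hs0 : 0 ≤ -s := by linarith [hs.2]
  have hs1 : -s ≤ 1 := by linarith [hs.1]
  have hA0 : 0 ≤ A := (abs_nonneg p).trans hp
  have hE0 : 0 ≤ E := (sq_nonneg e).trans he
  rw [abs_mul, abs_mul, abs_mul, abs_of_nonpos hs.2]
  calc |e| * (|p| * (|D| * -s)) = |p| * (|e| * |D| * -s) := by ring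
    _ ≤ A * ((L * e ^ 2 + L⁻¹ * D ^ 2) * -s) := by gcongr
    _ = A * (L * e ^ 2 * -s) + A * L⁻¹ * (D ^ 2 * -s) := by ring
    _ ≤ A * (L * E * 1) + A * L⁻¹ * (D ^ 2 * -s) := by gcongr
    _ = A * (L * E) + A * L⁻¹ * (D ^ 2 * -s) := by rw [mul_one]

-- Young's inequality with weight `N`: the error is `O(N⁻¹)` in squared mean, the kernel `O(N)`.
theorem abs_integral_error_mul_dirichletKernel_comp_le (H : IsBoundaryProfile h (Icc α β))
    (hαβ : α ≤ β) (hA : ∀ u ∈ Icc α β, |q u| ≤ A) (hK : 0 ≤ K)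
    (hσ : ∀ u ∈ Ioc α β,
      (dirichletPrimitive N (x - u) - σ) ^ 2 ≤ K / (1 + ((2 * N + 1) * (x - u)) ^ 2)) :
    |∫ u in α..β, (dirichletPrimitive N (x - u) - σ) *
      (q u * (dirichletKernel N (y - h u) * deriv h u))| ≤ A * (K * π + 2 * π) := by
  set L : ℝ := 2 * N + 1
  have hL : 0 < L := by positivity
  have hA0 : 0 ≤ A := (abs_nonneg _).trans (hA α (left_mem_Icc.2 hαβ))
  have hint₁ : IntervalIntegrable (fun u => A * K * (L / (1 + (L * (x - u)) ^ 2))) volume α β :=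
    (continuous_const.mul (continuous_const.div (by fun_prop) fun u => by positivity)
      ).intervalIntegrable _ _
  have hint₂ : IntervalIntegrable
      (fun u => A * L⁻¹ * (dirichletKernel N (y - h u) ^ 2 * -deriv h u)) volume α β :=
    ((((H.continuousOn_dirichletKernel_comp N y).pow 2).mul
      H.continuousOn_deriv.neg).intervalIntegrable_of_Icc hαβ).const_mul _
  have hpointwise : ∀ᵐ u, u ∈ Ioc α β → ‖(dirichletPrimitive N (x - u) - σ) *
      (q u * (dirichletKernel N (y - h u) * deriv h u))‖ ≤
      A * K * (L / (1 + (L * (x - u)) ^ 2)) +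
        A * L⁻¹ * (dirichletKernel N (y - h u) ^ 2 * -deriv h u) := by
    refine ae_of_all _ fun u hu => ?_
    have hu' := Ioc_subset_Icc_self hu
    refine (abs_mul_slope_le hL (hA u hu') (hσ u hu) (H.deriv_mem u hu')).trans_eq ?_
    ring
  refine (norm_integral_le_of_norm_le hαβ hpointwise (hint₁.add hint₂)).trans ?_
  rw [intervalIntegral.integral_add hint₁ hint₂, intervalIntegral.integral_const_mul,
    intervalIntegral.integral_const_mul]
  calc A * K * (∫ u in α..β, L / (1 + (L * (x - u)) ^ 2)) +
      A * L⁻¹ * ∫ u in α..β, dirichletKernel N (y - h u) ^ 2 * -deriv h u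
      ≤ A * K * π + A * L⁻¹ * (2 * π * L) := by
        gcongr
        exacts [integral_div_one_add_sq_le α β x, H.integral_dirichletKernel_sq_le N y hαβ]
    _ = A * (K * π + 2 * π) := by field_simp

theorem abs_integral_dirichletPrimitive_mul_le_of_near (H : IsBoundaryProfile h (Icc α β))
    (hαβ : α ≤ β) (hy : |y| ≤ π) (hq : ∀ v ∈ Icc α β, HasDerivAt q (q' v) v)
    (hq' : ContinuousOn q' (Icc α β)) (hA : ∀ v ∈ Icc α β, |q v| ≤ A)
    (hB : ∀ v ∈ Icc α β, |q' v| ≤ B) (hK : 0 ≤ K)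
    (hσ : ∀ u ∈ Ioc α β,
      (dirichletPrimitive N (x - u) - σ) ^ 2 ≤ K / (1 + ((2 * N + 1) * (x - u)) ^ 2)) :
    |∫ u in α..β, dirichletPrimitive N (x - u) *
      (q u * (dirichletKernel N (y - h u) * deriv h u))|
      ≤ |σ| * (5 * π * (2 * A + B * (β - α))) + A * (K * π + 2 * π) := by
  set k : ℝ → ℝ := fun u => q u * (dirichletKernel N (y - h u) * deriv h u)
  have hk : ContinuousOn k (Icc α β) :=
    ContinuousOn.mul (fun u hu => (hq u hu).continuousAt.continuousWithinAt)
      (H.continuousOn_dirichletKernel_comp_mul_deriv N y)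
  have hF : Continuous fun u => dirichletPrimitive N (x - u) - σ :=
    ((continuous_dirichletPrimitive N).comp (by fun_prop)).sub continuous_const
  have hsplit : (fun u => dirichletPrimitive N (x - u) * k u)
      = fun u => σ * k u + (dirichletPrimitive N (x - u) - σ) * k u := by
    funext u
    ring
  rw [hsplit, intervalIntegral.integral_add ((hk.intervalIntegrable_of_Icc hαβ).const_mul σ)
    ((hF.continuousOn.fun_mul hk).intervalIntegrable_of_Icc hαβ),
    intervalIntegral.integral_const_mul]
  refine (abs_add_le _ _).trans (add_le_add ?_
    (abs_integral_error_mul_dirichletKernel_comp_le N H hαβ hA hK hσ))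
  rw [abs_mul]
  gcongr
  exact abs_integral_mul_dirichletKernel_comp_le N H hαβ hy hq hq' hA hB

-- Split at `u = x`, where `dirichletPrimitive N (x - u)` jumps from near `π` to near `-π`.
theorem abs_integral_dirichletPrimitive_mul_le {b : ℝ} (H : IsBoundaryProfile h (Icc 0 b))
    (hb : 0 ≤ b) (hb' : b ≤ 3 * π / 4) (hx : |x| ≤ π) (hy : |y| ≤ π)
    (hq : ∀ v ∈ Icc 0 b, HasDerivAt q (q' v) v) (hq' : ContinuousOn q' (Icc 0 b))
    (hA : ∀ v ∈ Icc 0 b, |q v| ≤ A) (hB : ∀ v ∈ Icc 0 b, |q' v| ≤ B) :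
    |∫ u in 0..b, dirichletPrimitive N (x - u) *
      (q u * (dirichletKernel N (y - h u) * deriv h u))|
      ≤ 2 * (π * (5 * π * (2 * A + B * π)) + A * (800 * π ^ 2 * π + 2 * π)) := by
  obtain ⟨hx₁, hx₂⟩ := abs_le.1 hx
  have h0 := left_mem_Icc.2 hb
  have hB0 : 0 ≤ B := (abs_nonneg _).trans (hB 0 h0)
  have hpiece : ∀ α ∈ Icc 0 b, ∀ β ∈ Icc 0 b, α ≤ β → ∀ σ : ℝ, |σ| = π →
      (∀ u ∈ Ioc α β, (dirichletPrimitive N (x - u) - σ) ^ 2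
        ≤ 800 * π ^ 2 / (1 + ((2 * N + 1) * (x - u)) ^ 2)) →
      |∫ u in α..β, dirichletPrimitive N (x - u) *
        (q u * (dirichletKernel N (y - h u) * deriv h u))|
      ≤ π * (5 * π * (2 * A + B * π)) + A * (800 * π ^ 2 * π + 2 * π) := by
    intro α hα β hβ hαβ σ hσ hnear
    have hsub : Icc α β ⊆ Icc 0 b := Icc_subset_Icc hα.1 hβ.2
    have hlen : β - α ≤ π := by linarith [hα.1, hβ.2, pi_pos]
    refine (abs_integral_dirichletPrimitive_mul_le_of_near N (H.mono hsub) hαβ hy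
      (fun v hv => hq v (hsub hv)) (hq'.mono hsub) (fun v hv => hA v (hsub hv))
      (fun v hv => hB v (hsub hv)) (by positivity) hnear).trans ?_
    rw [hσ]
    gcongr
  set z := max 0 (min x b)
  have hz : z ∈ Icc 0 b := ⟨le_max_left _ _, max_le hb (min_le_right _ _)⟩
  have hleft := hpiece 0 h0 z hz hz.1 π (abs_of_pos pi_pos) fun u hu =>
    sq_dirichletPrimitive_sub_pi_le N (by grind) (by linarith [hu.1])
  have hright := hpiece z hz b (right_mem_Icc.2 hb) hz.2 (-π) (by rw [abs_neg, abs_of_pos pi_pos])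
    fun u hu => by
      rw [sub_neg_eq_add]
      exact sq_dirichletPrimitive_add_pi_le N (by grind) (by linarith [hu.2])
  have hcont : ContinuousOn (fun u => dirichletPrimitive N (x - u) *
      (q u * (dirichletKernel N (y - h u) * deriv h u))) (Icc 0 b) :=
    ((continuous_dirichletPrimitive N).comp (by fun_prop)).continuousOn.mul
      (ContinuousOn.mul (fun u hu => (hq u hu).continuousAt.continuousWithinAt)
        (H.continuousOn_dirichletKernel_comp_mul_deriv N y))
  rw [← integral_add_adjacent_intervals
    ((hcont.mono (Icc_subset_Icc le_rfl hz.2)).intervalIntegrable_of_Icc hz.1)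
    ((hcont.mono (Icc_subset_Icc hz.1 le_rfl)).intervalIntegrable_of_Icc hz.2)]
  linarith [abs_add_le _ _ |>.trans (add_le_add hleft hright)]

end DirichletKernelAlongProfile

/-- The partial sum kernel in the second variable, weighted by `r` and integrated from `c` to
`t`. -/
noncomputable def sliceIntegral (N : ℕ) (r : ℝ → ℝ) (c y t : ℝ) : ℝ :=
  ∫ v in c..t, dirichletKernel N (y - v) * r v

section UnderGraph

variable {b c x y K : ℝ} {h p r : ℝ → ℝ} (N : ℕ)

theorem hasDerivAt_sliceIntegral (hr : Continuous r) (c y t : ℝ) :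
    HasDerivAt (sliceIntegral N r c y) (dirichletKernel N (y - t) * r t) t := by
  have hcont : Continuous fun v => dirichletKernel N (y - v) * r v :=
    ((continuous_dirichletKernel N).comp (by fun_prop)).mul hr
  exact integral_hasDerivAt_right (hcont.intervalIntegrable _ _)
    (hcont.stronglyMeasurableAtFilter _ _) hcont.continuousAt

theorem continuous_sliceIntegral (hr : Continuous r) (c y : ℝ) :
    Continuous (sliceIntegral N r c y) :=
  continuous_iff_continuousAt.2 fun t => (hasDerivAt_sliceIntegral N hr c y t).continuousAt

theorem abs_sliceIntegral_le (hr : ContDiff ℝ 1 r)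
    (hK : ∀ t ∈ Icc 0 π, |r t| ≤ K ∧ |deriv r t| ≤ K) (hc : 0 ≤ c) (hy : |y| ≤ π) {t : ℝ}
    (hct : c ≤ t) (ht : t ≤ π) : |sliceIntegral N r c y t| ≤ 5 * π * (2 * K + K * π) := by
  have hsub : Icc c t ⊆ Icc 0 π := Icc_subset_Icc hc ht
  have hK0 : 0 ≤ K := (abs_nonneg _).trans (hK c (hsub (left_mem_Icc.2 hct))).1
  obtain ⟨hy₁, hy₂⟩ := abs_le.1 hy
  simp_rw [sliceIntegral, mul_comm (dirichletKernel N _)]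
  refine (abs_integral_mul_deriv_le_of_bounded hct
    (fun v _ => (hr.differentiable one_ne_zero v).hasDerivAt)
    (fun v _ => hasDerivAt_neg_dirichletPrimitive_sub N y v)
    (hr.continuous_deriv le_rfl).continuousOn
    ((continuous_dirichletKernel N).comp (by fun_prop)).continuousOn (M := 5 * π) (fun v hv => ?_)
    (fun v hv => (hK v (hsub hv)).1) (fun v hv => (hK v (hsub hv)).2)).trans ?_
  · rw [abs_neg]
    exact abs_dirichletPrimitive_le N
      (abs_le.2 ⟨by linarith [(hsub hv).2], by linarith [(hsub hv).1]⟩)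
  · gcongr
    linarith

theorem hasDerivAt_mul_sliceIntegral_comp (hp : Differentiable ℝ p) (hr : Continuous r)
    {u : ℝ} (hu : DifferentiableAt ℝ h u) :
    HasDerivAt (fun u => p u * sliceIntegral N r c y (h u))
      (deriv p u * sliceIntegral N r c y (h u) +
        p u * r (h u) * (dirichletKernel N (y - h u) * deriv h u)) u := by
  refine ((hp u).hasDerivAt.mul
    ((hasDerivAt_sliceIntegral N hr c y (h u)).comp u hu.hasDerivAt)).congr_deriv ?_
  simp only [Function.comp_def]
  ring

theorem continuousOn_deriv_mul_sliceIntegral_comp {s : Set ℝ} (H : IsBoundaryProfile h s)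
    (hp : ContDiff ℝ 1 p) (hr : Continuous r) :
    ContinuousOn (fun u => deriv p u * sliceIntegral N r c y (h u)) s :=
  (hp.continuous_deriv le_rfl).continuousOn.mul
    ((continuous_sliceIntegral N hr c y).comp_continuousOn H.continuousOn)

theorem continuousOn_boundary_term {s : Set ℝ} (H : IsBoundaryProfile h s) (hp : Continuous p)
    (hr : Continuous r) :
    ContinuousOn (fun u => p u * r (h u) * (dirichletKernel N (y - h u) * deriv h u)) s :=
  (hp.continuousOn.mul (hr.comp_continuousOn H.continuousOn)).mul
    (H.continuousOn_dirichletKernel_comp_mul_deriv N y)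

theorem abs_integral_boundary_term_le (H : IsBoundaryProfile h (Icc 0 b)) (hb : 0 ≤ b)
    (hb' : b ≤ 3 * π / 4) (hp : ContDiff ℝ 1 p) (hr : ContDiff ℝ 1 r)
    (hpK : ∀ t ∈ Icc 0 π, |p t| ≤ K ∧ |deriv p t| ≤ K)
    (hrK : ∀ t ∈ Icc 0 π, |r t| ≤ K ∧ |deriv r t| ≤ K) (hx : |x| ≤ π) (hy : |y| ≤ π) :
    |∫ u in 0..b, dirichletPrimitive N (x - u) *
      (p u * r (h u) * (dirichletKernel N (y - h u) * deriv h u))|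
      ≤ 2 * (π * (5 * π * (2 * (K * K) + 2 * (K * K) * π)) +
        K * K * (800 * π ^ 2 * π + 2 * π)) := by
  have hsub : Icc 0 b ⊆ Icc 0 π := Icc_subset_Icc le_rfl (by linarith [pi_pos])
  have hK0 : 0 ≤ K := (abs_nonneg _).trans (hpK 0 ⟨le_rfl, pi_pos.le⟩).1
  refine abs_integral_dirichletPrimitive_mul_le N H hb hb' hx hy (q := fun u => p u * r (h u))
    (q' := fun u => deriv p u * r (h u) + p u * (deriv r (h u) * deriv h u)) (fun u hu => ?_) ?_
    (fun u hu => ?_) (fun u hu => ?_)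
  · exact (hp.differentiable one_ne_zero u).hasDerivAt.mul
      ((hr.differentiable one_ne_zero (h u)).hasDerivAt.comp u (H.differentiableAt u hu).hasDerivAt)
  · exact ((hp.continuous_deriv le_rfl).continuousOn.mul
      (hr.continuous.comp_continuousOn H.continuousOn)).add (hp.continuous.continuousOn.mul
      (((hr.continuous_deriv le_rfl).comp_continuousOn H.continuousOn).mul H.continuousOn_deriv))
  · rw [abs_mul]
    exact mul_le_mul (hpK u (hsub hu)).1 (hrK _ (H.mapsTo hu)).1 (abs_nonneg _) hK0
  · have hslope : |deriv r (h u) * deriv h u| ≤ K := by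
      rw [abs_mul]
      exact (mul_le_of_le_one_right (abs_nonneg _) (H.abs_deriv_le_one hu)).trans
        (hrK _ (H.mapsTo hu)).2
    rw [two_mul]
    refine (abs_add_le _ _).trans (add_le_add ?_ ?_) <;> rw [abs_mul]
    · exact mul_le_mul (hpK u (hsub hu)).2 (hrK _ (H.mapsTo hu)).1 (abs_nonneg _) hK0
    · exact mul_le_mul (hpK u (hsub hu)).1 hslope (abs_nonneg _) hK0

theorem abs_integral_interior_term_le {S : ℝ} {Ψ : ℝ → ℝ} (hb : 0 ≤ b) (hb' : b ≤ 3 * π / 4)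
    (hpK : ∀ u ∈ Icc 0 b, |p u| ≤ K) (hΨ : ∀ u ∈ Icc 0 b, |Ψ u| ≤ S) (hx : |x| ≤ π) :
    |∫ u in 0..b, dirichletPrimitive N (x - u) * (p u * Ψ u)| ≤ 5 * π * (K * S) * π := by
  have h0 := left_mem_Icc.2 hb
  have hK0 : 0 ≤ K := (abs_nonneg _).trans (hpK 0 h0)
  have hS0 : 0 ≤ S := (abs_nonneg _).trans (hΨ 0 h0)
  obtain ⟨hx₁, hx₂⟩ := abs_le.1 hx
  have hbound : |∫ u in 0..b, dirichletPrimitive N (x - u) * (p u * Ψ u)|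
      ≤ 5 * π * (K * S) * |b - 0| := by
    rw [← norm_eq_abs]
    refine norm_integral_le_of_norm_le_const fun u hu => ?_
    replace hu : u ∈ Icc 0 b := Ioc_subset_Icc_self (uIoc_of_le hb ▸ hu)
    rw [norm_mul, norm_mul]
    gcongr
    · exact abs_dirichletPrimitive_le N
        (abs_le.2 ⟨by linarith [hu.2, pi_pos], by linarith [hu.1, pi_pos]⟩)
    · exact hpK u hu
    · exact hΨ u hu
  rw [sub_zero, abs_of_nonneg hb] at hbound
  refine hbound.trans ?_
  gcongr
  linarith [pi_pos]

theorem abs_integral_deriv_mul_dirichletPrimitive_le (H : IsBoundaryProfile h (Icc 0 b))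
    (hb : 0 ≤ b) (hb' : b ≤ 3 * π / 4) (hc : 0 ≤ c) (hch : ∀ u ∈ Icc 0 b, c ≤ h u)
    (hp : ContDiff ℝ 1 p) (hr : ContDiff ℝ 1 r) (hpK : ∀ t ∈ Icc 0 π, |p t| ≤ K ∧ |deriv p t| ≤ K)
    (hrK : ∀ t ∈ Icc 0 π, |r t| ≤ K ∧ |deriv r t| ≤ K) (hx : |x| ≤ π) (hy : |y| ≤ π) :
    |∫ u in 0..b, (deriv p u * sliceIntegral N r c y (h u) +
        p u * r (h u) * (dirichletKernel N (y - h u) * deriv h u)) * -dirichletPrimitive N (x - u)|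
      ≤ 5 * π * (K * (5 * π * (2 * K + K * π))) * π +
        2 * (π * (5 * π * (2 * (K * K) + 2 * (K * K) * π)) +
          K * K * (800 * π ^ 2 * π + 2 * π)) := by
  have hF : Continuous fun u => dirichletPrimitive N (x - u) :=
    (continuous_dirichletPrimitive N).comp (by fun_prop)
  have hsplit : (fun u => (deriv p u * sliceIntegral N r c y (h u) +
      p u * r (h u) * (dirichletKernel N (y - h u) * deriv h u)) * -dirichletPrimitive N (x - u))
      = fun u => -(dirichletPrimitive N (x - u) * (deriv p u * sliceIntegral N r c y (h u)) +
        dirichletPrimitive N (x - u) *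
          (p u * r (h u) * (dirichletKernel N (y - h u) * deriv h u))) := by
    funext u
    ring
  rw [hsplit, intervalIntegral.integral_neg, abs_neg, intervalIntegral.integral_add
    ((hF.continuousOn.fun_mul (continuousOn_deriv_mul_sliceIntegral_comp N H hp
      hr.continuous)).intervalIntegrable_of_Icc hb)
    ((hF.continuousOn.fun_mul (continuousOn_boundary_term N H hp.continuous
      hr.continuous)).intervalIntegrable_of_Icc hb)]
  exact (abs_add_le _ _).trans (add_le_add
    (abs_integral_interior_term_le N hb hb'
      (fun u hu => (hpK u ⟨hu.1, hu.2.trans (by linarith [pi_pos])⟩).2)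
      (fun u hu => abs_sliceIntegral_le N hr hrK hc hy (hch u hu) (H.mapsTo hu).2) hx)
    (abs_integral_boundary_term_le N H hb hb' hp hr hpK hrK hx hy))

-- Integrate by parts in `u`: differentiating the upper limit `h u` produces the boundary term.
theorem abs_integral_under_graph_le (H : IsBoundaryProfile h (Icc 0 b)) (hb : 0 ≤ b)
    (hb' : b ≤ 3 * π / 4) (hc : 0 ≤ c) (hch : ∀ u ∈ Icc 0 b, c ≤ h u) (hp : ContDiff ℝ 1 p)
    (hr : ContDiff ℝ 1 r) (hpK : ∀ t ∈ Icc 0 π, |p t| ≤ K ∧ |deriv p t| ≤ K)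
    (hrK : ∀ t ∈ Icc 0 π, |r t| ≤ K ∧ |deriv r t| ≤ K) (hx : |x| ≤ π) (hy : |y| ≤ π) :
    |∫ u in 0..b, p u * sliceIntegral N r c y (h u) * dirichletKernel N (x - u)|
      ≤ 5 * π * (2 * (K * (5 * π * (2 * K + K * π)))) +
        (5 * π * (K * (5 * π * (2 * K + K * π))) * π +
        2 * (π * (5 * π * (2 * (K * K) + 2 * (K * K) * π)) +
          K * K * (800 * π ^ 2 * π + 2 * π))) := by
  have hsub : Icc 0 b ⊆ Icc 0 π := Icc_subset_Icc le_rfl (by linarith [pi_pos])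
  have hK0 : 0 ≤ K := (abs_nonneg _).trans (hpK 0 ⟨le_rfl, pi_pos.le⟩).1
  obtain ⟨hx₁, hx₂⟩ := abs_le.1 hx
  have hφ : ∀ u ∈ Icc 0 b, |p u * sliceIntegral N r c y (h u)|
      ≤ K * (5 * π * (2 * K + K * π)) := fun u hu => by
    rw [abs_mul]
    exact mul_le_mul (hpK u (hsub hu)).1
      (abs_sliceIntegral_le N hr hrK hc hy (hch u hu) (H.mapsTo hu).2) (abs_nonneg _) hK0
  refine (abs_integral_mul_deriv_le_add hb (fun u hu => hasDerivAt_mul_sliceIntegral_comp N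
    (hp.differentiable one_ne_zero) hr.continuous (H.differentiableAt u hu))
    (fun u _ => hasDerivAt_neg_dirichletPrimitive_sub N x u)
    ((continuousOn_deriv_mul_sliceIntegral_comp N H hp hr.continuous).add
      (continuousOn_boundary_term N H hp.continuous hr.continuous))
    ((continuous_dirichletKernel N).comp (by fun_prop)).continuousOn (M := 5 * π)
    fun u hu => ?_).trans (add_le_add ?_
      (abs_integral_deriv_mul_dirichletPrimitive_le N H hb hb' hc hch hp hr hpK hrK hx hy))
  · rw [abs_neg]
    exact abs_dirichletPrimitive_le N
      (abs_le.2 ⟨by linarith [hu.2, pi_pos], by linarith [hu.1, pi_pos]⟩)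
  · gcongr
    linarith [hφ 0 (left_mem_Icc.2 hb), hφ b (right_mem_Icc.2 hb)]

end UnderGraph

theorem exists_bound_of_contDiff {p r : ℝ → ℝ} (hp : ContDiff ℝ 1 p) (hr : ContDiff ℝ 1 r)
    {s : Set ℝ} (hs : IsCompact s) : ∃ K, (∀ t ∈ s, |p t| ≤ K ∧ |deriv p t| ≤ K) ∧
      ∀ t ∈ s, |r t| ≤ K ∧ |deriv r t| ≤ K := by
  have hbound : ∀ f : ℝ → ℝ, ContDiff ℝ 1 f → ∃ C, ∀ t ∈ s, |f t| ≤ C ∧ |deriv f t| ≤ C :=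
    fun f hf => by
      obtain ⟨C₁, hC₁⟩ := hs.exists_bound_of_continuousOn hf.continuous.continuousOn
      obtain ⟨C₂, hC₂⟩ := hs.exists_bound_of_continuousOn (hf.continuous_deriv le_rfl).continuousOn
      exact ⟨max C₁ C₂, fun t ht => ⟨le_max_of_le_left (hC₁ t ht), le_max_of_le_right (hC₂ t ht)⟩⟩
  obtain ⟨P, hP⟩ := hbound p hp
  obtain ⟨R, hR⟩ := hbound r hr
  exact ⟨max P R, fun t ht => (hP t ht).imp le_max_of_le_left le_max_of_le_left,
    fun t ht => (hR t ht).imp le_max_of_le_right le_max_of_le_right⟩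

/-! ### Uniformly bounded square partial sums -/

/-- The boundary of the disk of radius `π` in the first quadrant, as a graph. -/
noncomputable def arc (u : ℝ) : ℝ := √(π ^ 2 - u ^ 2)

theorem pi_div_sqrt_two_sq : (π / √2) ^ 2 = π ^ 2 / 2 := by
  rw [div_pow, sq_sqrt zero_le_two]

theorem pi_div_sqrt_two_pos : 0 < π / √2 := by positivity

theorem pi_div_sqrt_two_le : π / √2 ≤ 3 * π / 4 := by
  refine (abs_le_of_sq_le_sq' ?_ (by positivity)).2
  rw [pi_div_sqrt_two_sq]
  nlinarith [sq_nonneg π]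

section Arc

variable {u : ℝ}

theorem arc_mem_Icc (hu : u ∈ Icc 0 (π / √2)) : arc u ∈ Icc (π / √2) π := by
  have hsq := pow_le_pow_left₀ hu.1 hu.2 2
  rw [pi_div_sqrt_two_sq] at hsq
  exact ⟨le_sqrt_of_sq_le (by rw [pi_div_sqrt_two_sq]; linarith),
    sqrt_le_iff.2 ⟨pi_pos.le, by nlinarith⟩⟩

theorem arc_pos (hu : u ∈ Icc 0 (π / √2)) : 0 < arc u :=
  pi_div_sqrt_two_pos.trans_le (arc_mem_Icc hu).1

theorem hasDerivAt_arc (hu : u ∈ Icc 0 (π / √2)) : HasDerivAt arc (-(u / arc u)) u := by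
  have hne : π ^ 2 - u ^ 2 ≠ 0 := (sqrt_pos.1 (arc_pos hu)).ne'
  refine (((hasDerivAt_pow 2 u).const_sub (π ^ 2)).sqrt hne).congr_deriv ?_
  rw [← arc]
  have := (arc_pos hu).ne'
  field_simp
  simp

theorem isBoundaryProfile_arc : IsBoundaryProfile arc (Icc 0 (π / √2)) where
  differentiableAt _ hu := (hasDerivAt_arc hu).differentiableAt
  continuousOn_deriv := by
    have hcont : ContinuousOn arc (Icc 0 (π / √2)) := fun u hu =>
      (hasDerivAt_arc hu).continuousAt.continuousWithinAt
    exact (continuousOn_id.div hcont fun u hu => (arc_pos hu).ne').neg.congr fun u hu =>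
      (hasDerivAt_arc hu).deriv
  deriv_mem u hu := by
    rw [(hasDerivAt_arc hu).deriv]
    exact ⟨neg_le_neg ((div_le_one (arc_pos hu)).2 (hu.2.trans (arc_mem_Icc hu).1)),
      neg_nonpos.2 (div_nonneg hu.1 (arc_pos hu).le)⟩
  mapsTo _ hu := ⟨(arc_pos hu).le, (arc_mem_Icc hu).2⟩

end Arc

/-- The kernel of the square partial sums of double Fourier series of period `2π`. -/
noncomputable def squareDirichletKernel (N : ℕ) (w z : ℝ × ℝ) : ℝ :=
  dirichletKernel N (w.1 - z.1) * dirichletKernel N (w.2 - z.2)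

theorem continuous_squareDirichletKernel (N : ℕ) (w : ℝ × ℝ) :
    Continuous (squareDirichletKernel N w) :=
  ((continuous_dirichletKernel N).comp (by fun_prop)).mul
    ((continuous_dirichletKernel N).comp (by fun_prop))

theorem squareDirichletKernel_swap (N : ℕ) (w z : ℝ × ℝ) :
    squareDirichletKernel N w z.swap = squareDirichletKernel N w.swap z :=
  mul_comm _ _

theorem squareDirichletKernel_neg_fst (N : ℕ) (w z : ℝ × ℝ) :
    squareDirichletKernel N w (-z.1, z.2) = squareDirichletKernel N (-w.1, w.2) z := by
  simp only [squareDirichletKernel]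
  rw [← dirichletKernel_neg N (w.1 - -z.1)]
  ring_nf

/-- The square partial Fourier sums of `g` cut off outside `S ⊆ [-π, π]²` are bounded on
`[-π, π]²`, uniformly in the order `N` and in the point `w`. -/
def HasBoundedPartialSums {E : Type*} [NormedAddCommGroup E] [NormedSpace ℝ E] (S : Set (ℝ × ℝ))
    (g : ℝ × ℝ → E) : Prop :=
  ∃ C, ∀ (N : ℕ) (w : ℝ × ℝ), |w.1| ≤ π → |w.2| ≤ π →
    ‖∫ z in S, squareDirichletKernel N w z • g z‖ ≤ C

theorem integrableOn_of_isBounded {X E : Type*} [MetricSpace X] [ProperSpace X]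
    [MeasurableSpace X] [OpensMeasurableSpace X] {μ : Measure X} [IsFiniteMeasureOnCompacts μ]
    [NormedAddCommGroup E] {g : X → E} (hg : Continuous g) {S : Set X}
    (hS : Bornology.IsBounded S) : IntegrableOn g S μ :=
  (hg.continuousOn.integrableOn_compact hS.isCompact_closure).mono_set subset_closure

theorem integrableOn_squareDirichletKernel_smul {E : Type*} [NormedAddCommGroup E]
    [NormedSpace ℝ E] {S : Set (ℝ × ℝ)} {g : ℝ × ℝ → E} (N : ℕ) (w : ℝ × ℝ) (hg : Continuous g)
    (hS : Bornology.IsBounded S) :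
    IntegrableOn (fun z => squareDirichletKernel N w z • g z) S :=
  integrableOn_of_isBounded ((continuous_squareDirichletKernel N w).smul hg) hS

namespace HasBoundedPartialSums

variable {E : Type*} [NormedAddCommGroup E] [NormedSpace ℝ E] {S T : Set (ℝ × ℝ)}
  {g g' : ℝ × ℝ → E}

theorem congr_set (h : HasBoundedPartialSums S g) (hST : S =ᵐ[volume] T) :
    HasBoundedPartialSums T g := by
  simpa only [HasBoundedPartialSums, setIntegral_congr_set hST] using h

theorem union (hS : HasBoundedPartialSums S g) (hT : HasBoundedPartialSums T g)
    (hST : Disjoint S T) (hTm : MeasurableSet T) (hg : Continuous g)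
    (hSb : Bornology.IsBounded S) (hTb : Bornology.IsBounded T) :
    HasBoundedPartialSums (S ∪ T) g := by
  obtain ⟨C, hC⟩ := hS
  obtain ⟨C', hC'⟩ := hT
  refine ⟨C + C', fun N w hw₁ hw₂ => ?_⟩
  rw [setIntegral_union hST hTm (integrableOn_squareDirichletKernel_smul N w hg hSb)
    (integrableOn_squareDirichletKernel_smul N w hg hTb)]
  exact (norm_add_le _ _).trans (add_le_add (hC N w hw₁ hw₂) (hC' N w hw₁ hw₂))

theorem add (h : HasBoundedPartialSums S g) (h' : HasBoundedPartialSums S g')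
    (hg : Continuous g) (hg' : Continuous g') (hS : Bornology.IsBounded S) :
    HasBoundedPartialSums S (g + g') := by
  obtain ⟨C, hC⟩ := h
  obtain ⟨C', hC'⟩ := h'
  refine ⟨C + C', fun N w hw₁ hw₂ => ?_⟩
  simp only [Pi.add_apply, smul_add]
  rw [integral_add (integrableOn_squareDirichletKernel_smul N w hg hS)
    (integrableOn_squareDirichletKernel_smul N w hg' hS)]
  exact (norm_add_le _ _).trans (add_le_add (hC N w hw₁ hw₂) (hC' N w hw₁ hw₂))

theorem preimage_swap (h : HasBoundedPartialSums S g) :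
    HasBoundedPartialSums (Prod.swap ⁻¹' S) (g ∘ Prod.swap) := by
  obtain ⟨C, hC⟩ := h
  refine ⟨C, fun N w hw₁ hw₂ => ?_⟩
  have hmp : MeasurePreserving (Prod.swap : ℝ × ℝ → ℝ × ℝ) volume volume :=
    Measure.measurePreserving_swap
  have hswap := hmp.setIntegral_preimage_emb MeasurableEquiv.prodComm.measurableEmbedding
    (fun z => squareDirichletKernel N w z.swap • g z) S
  simp only [Prod.swap_swap, squareDirichletKernel_swap] at hswap
  exact (congrArg norm hswap).trans_le (hC N w.swap hw₂ hw₁)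

theorem preimage_neg_fst (h : HasBoundedPartialSums S fun z => g (-z.1, z.2)) :
    HasBoundedPartialSums ((fun z : ℝ × ℝ => (-z.1, z.2)) ⁻¹' S) g := by
  obtain ⟨C, hC⟩ := h
  refine ⟨C, fun N w hw₁ hw₂ => ?_⟩
  have hneg := ((Measure.measurePreserving_neg (volume : Measure ℝ)).prod
    (MeasurePreserving.id (volume : Measure ℝ))).setIntegral_preimage_emb
    ((MeasurableEquiv.neg ℝ).prodCongr (MeasurableEquiv.refl ℝ)).measurableEmbedding
    (fun z => squareDirichletKernel N w (-z.1, z.2) • g (-z.1, z.2)) S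
  simp only [Prod.map_fst, Prod.map_snd, id_eq, neg_neg, Prod.mk.eta,
    squareDirichletKernel_neg_fst] at hneg
  exact (congrArg norm hneg).trans_le (hC N (-w.1, w.2) (by rwa [abs_neg]) hw₂)

theorem of_inter_fst_pos (hS : (fun z : ℝ × ℝ => (-z.1, z.2)) ⁻¹' S = S) (hSm : MeasurableSet S)
    (hSb : Bornology.IsBounded S) (hg : Continuous g)
    (h : HasBoundedPartialSums (S ∩ {z | 0 < z.1}) g)
    (h' : HasBoundedPartialSums (S ∩ {z | 0 < z.1}) fun z => g (-z.1, z.2)) :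
    HasBoundedPartialSums S g := by
  have hleft : (fun z : ℝ × ℝ => (-z.1, z.2)) ⁻¹' (S ∩ {z | 0 < z.1}) = S ∩ {z | z.1 < 0} := by
    rw [preimage_inter, hS]
    simp
  have hm : MeasurableSet (S ∩ {z : ℝ × ℝ | z.1 < 0}) :=
    hSm.inter (measurableSet_lt measurable_fst measurable_const)
  have hpieces := h.union (hleft ▸ h'.preimage_neg_fst) (disjoint_left.2 fun z hz hz' =>
    lt_asymm (mem_ofPred.1 hz.2) hz'.2) hm hg (hSb.subset inter_subset_left)
    (hSb.subset inter_subset_left)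
  refine hpieces.congr_set ?_
  have hne : ∀ᵐ z : ℝ × ℝ, z.1 ≠ 0 := Measure.quasiMeasurePreserving_fst.ae (Measure.ae_ne volume 0)
  filter_upwards [hne] with z hz
  rw [← inter_union_distrib_left]
  exact propext ⟨fun hz' => hz'.1, fun hz' => ⟨hz', hz.lt_or_gt.symm⟩⟩

end HasBoundedPartialSums

theorem measurableSet_disk (ρ : ℝ) : MeasurableSet (disk ρ) :=
  measurableSet_le (by fun_prop) (by fun_prop)

theorem disk_subset_Icc {ρ : ℝ} (hρ : 0 ≤ ρ) : disk ρ ⊆ Icc (-ρ) ρ ×ˢ Icc (-ρ) ρ := by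
  intro z (hz : z.1 ^ 2 + z.2 ^ 2 ≤ ρ ^ 2)
  exact ⟨abs_le_of_sq_le_sq' (by nlinarith [sq_nonneg z.2]) hρ,
    abs_le_of_sq_le_sq' (by nlinarith [sq_nonneg z.1]) hρ⟩

theorem isBounded_disk {ρ : ℝ} (hρ : 0 ≤ ρ) : Bornology.IsBounded (disk ρ) :=
  (isCompact_Icc.prod isCompact_Icc).isBounded.subset (disk_subset_Icc hρ)

theorem setIntegral_eq_intervalIntegral_of_slice {E : Type*} [NormedAddCommGroup E]
    [NormedSpace ℝ E] {α β : ℝ} {l h : ℝ → ℝ} {S : Set (ℝ × ℝ)} {f : ℝ × ℝ → E} (hαβ : α ≤ β)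
    (hlh : ∀ u ∈ Ioc α β, l u ≤ h u) (hSm : MeasurableSet S) (hS : S ⊆ Ioc α β ×ˢ univ)
    (hslice : ∀ u ∈ Ioc α β, Prod.mk u ⁻¹' S = Ioc (l u) (h u)) (hf : IntegrableOn f S) :
    ∫ z in S, f z = ∫ u in α..β, ∫ v in (l u)..(h u), f (u, v) := by
  have hf' : IntegrableOn (S.indicator f) (Ioc α β ×ˢ univ) :=
    ((integrable_indicator_iff hSm).2 hf).integrableOn
  rw [← inter_eq_right.2 hS, ← setIntegral_indicator hSm, Measure.volume_eq_prod,
    setIntegral_prod _ hf', integral_of_le hαβ]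
  refine setIntegral_congr_fun measurableSet_Ioc fun u hu => ?_
  rw [integral_of_le (hlh u hu), setIntegral_univ, ← hslice u hu,
    ← MeasureTheory.integral_indicator (hSm.preimage measurable_prodMk_left)]
  rfl

theorem setIntegral_cap_eq {f : ℝ × ℝ → ℝ} (hf : Continuous f) :
    ∫ z in disk π ∩ Ioc 0 (π / √2) ×ˢ Ioi (π / √2), f z =
      ∫ u in 0..(π / √2), ∫ v in (π / √2)..(arc u), f (u, v) := by
  refine setIntegral_eq_intervalIntegral_of_slice pi_div_sqrt_two_pos.le
    (fun u hu => (arc_mem_Icc (Ioc_subset_Icc_self hu)).1)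
    ((measurableSet_disk π).inter (measurableSet_Ioc.prod measurableSet_Ioi))
    (fun z hz => ⟨hz.2.1, mem_univ _⟩) (fun u hu => ?_)
    (integrableOn_of_isBounded hf ((isBounded_disk pi_pos.le).subset inter_subset_left))
  ext v
  simp only [disk, mem_preimage, mem_inter_iff, mem_ofPred_eq, mem_prod, hu, true_and, mem_Ioi,
    mem_Ioc]
  rw [and_comm, and_congr_right_iff]
  intro hv
  rw [arc, le_sqrt' (pi_div_sqrt_two_pos.trans hv)]
  constructor <;> intro <;> linarith

section ProductWeight

variable {p r : ℝ → ℝ}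

theorem hasBoundedPartialSums_square (hp : ContDiff ℝ 1 p) (hr : ContDiff ℝ 1 r) :
    HasBoundedPartialSums (Ioc 0 (π / √2) ×ˢ Ioc 0 (π / √2)) fun z => p z.1 * r z.2 := by
  obtain ⟨K, hpK, hrK⟩ := exists_bound_of_contDiff hp hr (isCompact_Icc (a := 0) (b := π))
  have hle : π / √2 ≤ π := pi_div_sqrt_two_le.trans (by linarith [pi_pos])
  refine ⟨5 * π * (2 * K + K * π) * (5 * π * (2 * K + K * π)), fun N w hw₁ hw₂ => ?_⟩
  have hprod : ∫ z in Ioc 0 (π / √2) ×ˢ Ioc 0 (π / √2),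
      squareDirichletKernel N w z • (p z.1 * r z.2) =
      sliceIntegral N p 0 w.1 (π / √2) * sliceIntegral N r 0 w.2 (π / √2) := by
    rw [sliceIntegral, sliceIntegral, integral_of_le pi_div_sqrt_two_pos.le,
      integral_of_le pi_div_sqrt_two_pos.le, ← setIntegral_prod_mul, Measure.volume_eq_prod]
    refine integral_congr_ae (.of_forall fun z => ?_)
    simp only [squareDirichletKernel, smul_eq_mul]
    ring
  rw [hprod, norm_mul]
  have hp' := abs_sliceIntegral_le N hp hpK le_rfl hw₁ pi_div_sqrt_two_pos.le hle
  have hr' := abs_sliceIntegral_le N hr hrK le_rfl hw₂ pi_div_sqrt_two_pos.le hle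
  exact mul_le_mul hp' hr' (abs_nonneg _) ((abs_nonneg _).trans hp')

theorem hasBoundedPartialSums_cap (hp : ContDiff ℝ 1 p) (hr : ContDiff ℝ 1 r) :
    HasBoundedPartialSums (disk π ∩ Ioc 0 (π / √2) ×ˢ Ioi (π / √2)) fun z => p z.1 * r z.2 := by
  obtain ⟨K, hpK, hrK⟩ := exists_bound_of_contDiff hp hr (isCompact_Icc (a := 0) (b := π))
  refine ⟨_, fun N w hw₁ hw₂ => le_of_eq_of_le (congrArg norm ?_) (abs_integral_under_graph_le N
    isBoundaryProfile_arc pi_div_sqrt_two_pos.le pi_div_sqrt_two_le pi_div_sqrt_two_pos.le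
    (fun u hu => (arc_mem_Icc hu).1) hp hr hpK hrK hw₁ hw₂)⟩
  refine (setIntegral_cap_eq ((continuous_squareDirichletKernel N w).fun_smul
    ((hp.continuous.comp continuous_fst).mul (hr.continuous.comp continuous_snd)))).trans
    (intervalIntegral.integral_congr fun u _ => ?_)
  simp only [sliceIntegral, squareDirichletKernel, smul_eq_mul, Pi.mul_apply, Function.comp_apply]
  rw [mul_right_comm, ← intervalIntegral.integral_const_mul]
  congr 1
  funext v
  ring

theorem quadrant_eq : disk π ∩ Ioi 0 ×ˢ Ioi 0 =
    Ioc 0 (π / √2) ×ˢ Ioc 0 (π / √2) ∪ (disk π ∩ Ioc 0 (π / √2) ×ˢ Ioi (π / √2) ∪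
      disk π ∩ Ioi (π / √2) ×ˢ Ioc 0 (π / √2)) := by
  have hsq := pi_div_sqrt_two_sq
  have hpos := pi_div_sqrt_two_pos
  ext ⟨u, v⟩
  simp only [disk, mem_inter_iff, mem_union, mem_prod, mem_Ioi, mem_Ioc, mem_ofPred_eq]
  constructor
  · rintro ⟨hdisk, hu, hv⟩
    rcases le_or_gt u (π / √2) with hu' | hu' <;> rcases le_or_gt v (π / √2) with hv' | hv'
    · exact .inl ⟨⟨hu, hu'⟩, hv, hv'⟩
    · exact .inr (.inl ⟨hdisk, ⟨hu, hu'⟩, hv'⟩)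
    · exact .inr (.inr ⟨hdisk, hu', hv, hv'⟩)
    · nlinarith
  · rintro (⟨⟨hu, hu'⟩, hv, hv'⟩ | ⟨hdisk, ⟨hu, -⟩, hv⟩ | ⟨hdisk, hu, hv, -⟩)
    · exact ⟨by nlinarith, hu, hv⟩
    · exact ⟨hdisk, hu, hpos.trans hv⟩
    · exact ⟨hdisk, hpos.trans hu, hv⟩

theorem hasBoundedPartialSums_quadrant (hp : ContDiff ℝ 1 p) (hr : ContDiff ℝ 1 r) :
    HasBoundedPartialSums (disk π ∩ Ioi 0 ×ˢ Ioi 0) fun z => p z.1 * r z.2 := by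
  have hcont : Continuous fun z : ℝ × ℝ => p z.1 * r z.2 :=
    (hp.continuous.comp continuous_fst).mul (hr.continuous.comp continuous_snd)
  have hcap : HasBoundedPartialSums (disk π ∩ Ioi (π / √2) ×ˢ Ioc 0 (π / √2))
      fun z => p z.1 * r z.2 := by
    convert (hasBoundedPartialSums_cap hr hp).preimage_swap using 1
    · ext z
      simp only [disk, mem_preimage, mem_inter_iff, mem_ofPred_eq, Prod.fst_swap, Prod.snd_swap,
        mem_prod, add_comm]
      tauto
    · funext z
      exact mul_comm _ _
  have hdisk {S : Set (ℝ × ℝ)} : Bornology.IsBounded (disk π ∩ S) :=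
    (isBounded_disk pi_pos.le).subset inter_subset_left
  have hm {S T : Set ℝ} (hS : MeasurableSet S) (hT : MeasurableSet T) :
      MeasurableSet (disk π ∩ S ×ˢ T) := (measurableSet_disk π).inter (hS.prod hT)
  rw [quadrant_eq]
  refine (hasBoundedPartialSums_square hp hr).union ((hasBoundedPartialSums_cap hp hr).union hcap
    ?_ (hm measurableSet_Ioi measurableSet_Ioc) hcont hdisk hdisk) ?_
    ((hm measurableSet_Ioc measurableSet_Ioi).union (hm measurableSet_Ioi measurableSet_Ioc)) hcont
    ((Metric.isBounded_Ioc 0 _).prod (Metric.isBounded_Ioc 0 _)) (hdisk.union hdisk)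
  · rw [disjoint_left]
    rintro z ⟨-, hu, -⟩ ⟨-, hu', -⟩
    exact hu.2.not_gt hu'
  · rw [disjoint_left]
    rintro z ⟨hu, hv⟩ (⟨-, -, hv'⟩ | ⟨-, hu', -⟩)
    exacts [hv.2.not_gt hv', hu.2.not_gt hu']

theorem hasBoundedPartialSums_halfDisk (hp : ContDiff ℝ 1 p) (hr : ContDiff ℝ 1 r) :
    HasBoundedPartialSums (disk π ∩ {z | 0 < z.2}) fun z => p z.1 * r z.2 := by
  have hset : disk π ∩ {z | 0 < z.2} ∩ {z | 0 < z.1} = disk π ∩ Ioi 0 ×ˢ Ioi 0 := by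
    ext z
    simp only [mem_inter_iff, mem_ofPred_eq, mem_prod, mem_Ioi]
    tauto
  refine HasBoundedPartialSums.of_inter_fst_pos ?_
    ((measurableSet_disk π).inter (measurableSet_lt measurable_const measurable_snd))
    ((isBounded_disk pi_pos.le).subset inter_subset_left)
    ((hp.continuous.comp continuous_fst).mul (hr.continuous.comp continuous_snd)) ?_ ?_
  · simp [disk, preimage_inter]
  · exact hset ▸ hasBoundedPartialSums_quadrant hp hr
  · exact hset ▸ hasBoundedPartialSums_quadrant (hp.comp contDiff_neg) hr

theorem hasBoundedPartialSums_disk (hp : ContDiff ℝ 1 p) (hr : ContDiff ℝ 1 r) :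
    HasBoundedPartialSums (disk π) fun z => p z.1 * r z.2 := by
  have hright {p : ℝ → ℝ} (hp : ContDiff ℝ 1 p) :
      HasBoundedPartialSums (disk π ∩ {z | 0 < z.1}) fun z => p z.1 * r z.2 := by
    convert (hasBoundedPartialSums_halfDisk hr hp).preimage_swap using 1
    · ext z
      simp [disk, add_comm]
    · funext z
      exact mul_comm _ _
  refine HasBoundedPartialSums.of_inter_fst_pos ?_ (measurableSet_disk π)
    (isBounded_disk pi_pos.le)
    ((hp.continuous.comp continuous_fst).mul (hr.continuous.comp continuous_snd)) (hright hp)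
    (hright (hp.comp contDiff_neg))
  simp [disk]

end ProductWeight

theorem continuous_eval_pair (P : MvPolynomial (Fin 2) ℂ) :
    Continuous fun z : ℝ × ℝ => MvPolynomial.eval ![(z.1 : ℂ), (z.2 : ℂ)] P := by
  refine (MvPolynomial.continuous_eval P).comp (continuous_pi fun i => ?_)
  fin_cases i
  exacts [Complex.continuous_ofReal.comp continuous_fst,
    Complex.continuous_ofReal.comp continuous_snd]

theorem hasBoundedPartialSums_disk_eval (P : MvPolynomial (Fin 2) ℂ) :
    HasBoundedPartialSums (disk π) fun z => MvPolynomial.eval ![(z.1 : ℂ), (z.2 : ℂ)] P := by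
  induction P using MvPolynomial.induction_on' with
  | monomial s c =>
    obtain ⟨C, hC⟩ := hasBoundedPartialSums_disk (p := (· ^ s 0)) (r := (· ^ s 1))
      (contDiff_id.pow _) (contDiff_id.pow _)
    refine ⟨‖c‖ * C, fun N w hw₁ hw₂ => ?_⟩
    have hmonomial (z : ℝ × ℝ) : squareDirichletKernel N w z •
        MvPolynomial.eval ![(z.1 : ℂ), (z.2 : ℂ)] (MvPolynomial.monomial s c) =
        c * ((squareDirichletKernel N w z • (z.1 ^ s 0 * z.2 ^ s 1) : ℝ) : ℂ) := by
      rw [MvPolynomial.eval_monomial, Finsupp.prod_fintype _ _ (by simp), Fin.prod_univ_two,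
        Complex.real_smul]
      simp only [Matrix.cons_val_zero, Matrix.cons_val_one, smul_eq_mul]
      push_cast
      ring
    simp_rw [hmonomial]
    rw [MeasureTheory.integral_const_mul, integral_complex_ofReal, norm_mul, Complex.norm_real]
    gcongr
    exact hC N w hw₁ hw₂
  | add P Q hP hQ =>
    simp only [map_add]
    exact hP.add hQ (continuous_eval_pair P) (continuous_eval_pair Q) (isBounded_disk pi_pos.le)

/-! ### Moments of the radial Zernike polynomials -/

theorem prod_erase_range_natCast_sub {R : Type*} [CommRing R] {l i : ℕ} (hi : i ≤ l) :
    ∏ j ∈ (Finset.range (l + 1)).erase i, ((j : R) - i)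
      = (-1) ^ i * (i.factorial * (l - i).factorial) := by
  induction l, hi using Nat.le_induction with
  | base =>
    have hrange : (Finset.range (i + 1)).erase i = Finset.range i := by
      ext j; simp only [Finset.mem_erase, Finset.mem_range]; lia
    have hneg : ∀ j ∈ Finset.range i, (j : R) - i = -1 * (i - j) := fun j _ => by ring
    rw [hrange, Finset.prod_congr rfl hneg, Finset.prod_mul_distrib, Finset.prod_const,
      Finset.card_range, Finset.prod_range_natCast_sub, ← Nat.descFactorial_eq_prod_range,
      Nat.descFactorial_self]
    simp
  | succ l hl ih =>
    have hinsert : (Finset.range (l + 1 + 1)).erase i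
        = insert (l + 1) ((Finset.range (l + 1)).erase i) := by
      ext j; simp only [Finset.mem_erase, Finset.mem_range, Finset.mem_insert]; lia
    rw [hinsert, Finset.prod_insert (by simp), ih, show l + 1 - i = (l - i) + 1 by lia,
      Nat.factorial_succ]
    push_cast [Nat.cast_sub hl]
    ring

theorem eval_div_prod_add_natCast {K : Type*} [Field K] [CharZero K] {P : Polynomial K} {l : ℕ}
    (hP : P.natDegree ≤ l) {x c : K} (hx : ∀ i ∈ Finset.range (l + 1), x + (c + i) ≠ 0) :
    P.eval x / ∏ i ∈ Finset.range (l + 1), (x + (c + i))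
      = ∑ i ∈ Finset.range (l + 1),
          (-1) ^ i / (i.factorial * (l - i).factorial) * P.eval (-(c + i)) / (x + (c + i)) := by
  set v : ℕ → K := fun i => -(c + i) with hv
  have hsub : ∀ i, x - v i = x + (c + i) := fun i => by simp only [hv]; ring
  have hinj : Set.InjOn v (Finset.range (l + 1)) := fun i _ j _ hij => by
    simpa [hv] using hij
  have hdeg : P.degree < (Finset.range (l + 1)).card := by
    rw [Finset.card_range]
    exact Polynomial.degree_le_natDegree.trans_lt (by exact_mod_cast Nat.lt_succ_of_le hP)
  have hweight : ∀ i ∈ Finset.range (l + 1), Lagrange.nodalWeight (Finset.range (l + 1)) v i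
      = (-1) ^ i / (i.factorial * (l - i).factorial) := fun i hi => by
    have hdiff : ∀ j, v i - v j = (j : K) - i := fun j => by simp only [hv]; ring
    rw [Lagrange.nodalWeight, Finset.prod_inv_distrib]
    simp_rw [hdiff]
    rw [prod_erase_range_natCast_sub (Finset.mem_range_succ_iff.1 hi), mul_inv, ← inv_pow,
      inv_neg_one, div_eq_mul_inv]
  have hne : ∀ i ∈ Finset.range (l + 1), x ≠ v i := fun i hi h =>
    hx i hi (by rw [← hsub, sub_eq_zero.2 h])
  have hinterp := congrArg (Polynomial.eval x) (Lagrange.eq_interpolate hinj hdeg)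
  rw [Lagrange.eval_interpolate_not_at_node _ hne, Lagrange.eval_nodal] at hinterp
  simp_rw [hsub] at hinterp
  rw [hinterp, mul_div_cancel_left₀ _ (Finset.prod_ne_zero_iff.2 hx)]
  refine Finset.sum_congr rfl fun i hi => ?_
  rw [hweight i hi]
  ring

theorem eval_descPochhammer_neg_add_one {K : Type*} [Field K] [CharZero K] (q l : ℕ) :
    (descPochhammer K l).eval (-((q : K) + 1))
      = (-1) ^ l * ((q + l).factorial / q.factorial) := by
  have hasc := ascPochhammer_eval_neg_eq_descPochhammer K (-((q : K) + 1)) l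
  rw [neg_neg, ← Nat.cast_add_one, ascPochhammer_nat_eq_natCast_ascFactorial] at hasc
  rw [← Nat.factorial_mul_ascFactorial, Nat.cast_mul, hasc,
    mul_div_cancel_left₀ _ (Nat.cast_ne_zero.2 q.factorial_ne_zero), ← mul_assoc, ← mul_pow,
    neg_one_mul, neg_neg, one_pow, one_mul, Nat.cast_add_one]

/-- Partial fractions of `x(x-1)⋯(x-l+1) / ((x+μ+1)⋯(x+μ+l+1))`, evaluated at `x = p`. -/
theorem sum_neg_one_pow_mul_factorial_div (μ l p : ℕ) :
    ∑ i ∈ Finset.range (l + 1), (-1 : ℝ) ^ (l + i) * ((μ + l + i).factorial /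
      (i.factorial * (l - i).factorial * (μ + i).factorial)) / (μ + p + i + 1)
      = p.descFactorial l * (p + μ).factorial / (p + μ + l + 1).factorial := by
  have hprod : ∏ i ∈ Finset.range (l + 1), ((p : ℝ) + ((μ + 1 : ℝ) + i))
      = (p + μ + l + 1).factorial / (p + μ).factorial := by
    rw [add_assoc (p + μ), ← Nat.factorial_mul_ascFactorial, Nat.ascFactorial_eq_prod_range]
    push_cast
    rw [mul_div_cancel_left₀ _ (by positivity)]
    exact Finset.prod_congr rfl fun i _ => by ring
  have hfrac := eval_div_prod_add_natCast (P := descPochhammer ℝ l)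
    (descPochhammer_natDegree ℝ l).le (x := p) (c := μ + 1) fun i _ => by positivity
  rw [hprod, descPochhammer_eval_eq_descFactorial, div_div_eq_mul_div] at hfrac
  rw [hfrac]
  refine Finset.sum_congr rfl fun i _ => ?_
  rw [show -((μ : ℝ) + 1 + i) = -(((μ + i : ℕ) : ℝ) + 1) by push_cast; ring,
    eval_descPochhammer_neg_add_one, show μ + i + l = μ + l + i by ring,
    show (p : ℝ) + (μ + 1 + i) = μ + p + i + 1 by ring, pow_add]
  field_simp

theorem continuous_zernikeRadial (n : ℕ) (m : ℤ) : Continuous (zernikeRadial n m) := by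
  unfold zernikeRadial; fun_prop

theorem zernikeRadial_natAbs_add_two_mul (m : ℤ) (l : ℕ) (ρ : ℝ) :
    zernikeRadial (m.natAbs + 2 * l) m ρ
      = ∑ i ∈ Finset.range (l + 1), (-1 : ℝ) ^ (l + i) * ((m.natAbs + l + i).factorial /
          (i.factorial * (l - i).factorial * (m.natAbs + i).factorial)) *
          ρ ^ (m.natAbs + 2 * i) := by
  set μ := m.natAbs with hμ
  rw [zernikeRadial, ← hμ, show (μ + 2 * l - μ) / 2 = l by lia,
    show (μ + 2 * l + μ) / 2 = μ + l by lia, ← Finset.sum_range_reflect]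
  refine Finset.sum_congr rfl fun i hi => ?_
  have hil : i ≤ l := Finset.mem_range_succ_iff.1 hi
  have hsign : (-1 : ℝ) ^ (l - i) = (-1) ^ (l + i) := by
    rw [show l + i = (l - i) + 2 * i by lia, pow_add, pow_mul]; simp
  rw [show l + 1 - 1 - i = l - i by lia, show μ + 2 * l - (l - i) = μ + l + i by lia,
    show μ + l - (l - i) = μ + i by lia, show l - (l - i) = i by lia,
    show μ + 2 * l - 2 * (l - i) = μ + 2 * i by lia, hsign]
  ring

theorem integral_pow_mul_zernikeRadial (m : ℤ) (l p : ℕ) :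
    ∫ ρ in (0 : ℝ)..1, ρ ^ (2 * p + m.natAbs) * (zernikeRadial (m.natAbs + 2 * l) m ρ * ρ)
      = p.descFactorial l * (p + m.natAbs).factorial / (2 * (p + m.natAbs + l + 1).factorial) := by
  simp_rw [zernikeRadial_natAbs_add_two_mul]
  set μ := m.natAbs
  have hterm : ∀ ρ : ℝ, ρ ^ (2 * p + μ) * ((∑ i ∈ Finset.range (l + 1), (-1 : ℝ) ^ (l + i) *
      ((μ + l + i).factorial / (i.factorial * (l - i).factorial * (μ + i).factorial)) *
        ρ ^ (μ + 2 * i)) * ρ)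
      = ∑ i ∈ Finset.range (l + 1), (-1 : ℝ) ^ (l + i) * ((μ + l + i).factorial /
          (i.factorial * (l - i).factorial * (μ + i).factorial)) * ρ ^ (2 * (μ + p + i) + 1) := by
    intro ρ
    rw [Finset.sum_mul, Finset.mul_sum]
    exact Finset.sum_congr rfl fun i _ => by ring
  have hpow : ∀ i : ℕ, ∫ ρ in (0 : ℝ)..1, ρ ^ (2 * (μ + p + i) + 1)
      = (μ + p + i + 1 : ℝ)⁻¹ / 2 := fun i => by
    rw [integral_pow, one_pow, zero_pow (Nat.succ_ne_zero _), sub_zero, one_div, div_eq_mul_inv,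
      ← mul_inv]
    push_cast
    ring
  simp_rw [hterm]
  rw [intervalIntegral.integral_finsetSum
    fun i _ => Continuous.intervalIntegrable (by fun_prop) _ _]
  simp_rw [intervalIntegral.integral_const_mul, hpow]
  rw [mul_comm (2 : ℝ), ← div_div, ← sum_neg_one_pow_mul_factorial_div μ l p, Finset.sum_div]
  exact Finset.sum_congr rfl fun i _ => by ring

/-! ### Bessel functions and the Hankel transform -/

theorem summable_besselJ_bound (q : ℕ) (x : ℝ) :
    Summable fun j : ℕ => |x / 2| ^ (2 * j + q) / (j.factorial * (j + q).factorial) := by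
  refine Summable.of_nonneg_of_le (fun j => by positivity) (fun j => ?_)
    ((Real.summable_pow_div_factorial (|x / 2| ^ 2)).mul_left (|x / 2| ^ q))
  rw [pow_add, pow_mul, mul_comm (|x / 2| ^ q), div_mul_eq_mul_div]
  gcongr
  exact le_mul_of_one_le_right (by positivity) (by exact_mod_cast Nat.factorial_pos _)

theorem norm_besselJ_term (q j : ℕ) (x : ℝ) :
    ‖(-1 : ℝ) ^ j / ((j.factorial : ℝ) * ((j + q).factorial : ℝ)) * (x / 2) ^ (2 * j + q)‖
      = |x / 2| ^ (2 * j + q) / (j.factorial * (j + q).factorial) := by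
  rw [norm_mul, norm_div, norm_pow, norm_pow, norm_neg, norm_one, one_pow, norm_eq_abs, norm_eq_abs,
    abs_of_nonneg (by positivity : (0 : ℝ) ≤ (j.factorial : ℝ) * ((j + q).factorial : ℝ)),
    one_div_mul_eq_div]

theorem hasSum_besselJ (q : ℕ) (x : ℝ) :
    HasSum (fun j : ℕ => (-1 : ℝ) ^ j / ((j.factorial : ℝ) * ((j + q).factorial : ℝ)) *
      (x / 2) ^ (2 * j + q)) (besselJ q x) :=
  (Summable.of_norm ((summable_besselJ_bound q x).congr fun j =>
    (norm_besselJ_term q j x).symm)).hasSum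

theorem hasSum_besselQuotient (n : ℕ) (κ : ℝ) :
    HasSum (fun j : ℕ => (-1 : ℝ) ^ j / ((j.factorial : ℝ) * ((j + (n + 1)).factorial : ℝ)) *
      ((π / 2) ^ (2 * j + (n + 1)) * κ ^ (2 * j + n))) (besselQuotient n κ) := by
  unfold besselQuotient
  split_ifs with hκ hn
  · subst hκ hn
    convert hasSum_single (0 : ℕ) (fun j hj => ?_) using 1
    · simp
    · rw [zero_pow (by lia), mul_zero, mul_zero]
  · subst hκ
    convert hasSum_zero with j
    rw [zero_pow (by lia), mul_zero, mul_zero]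
  · refine ((hasSum_besselJ (n + 1) (π * κ)).div_const κ).congr_fun fun j => ?_
    rw [show π * κ / 2 = π / 2 * κ by ring, mul_pow, ← add_assoc (2 * j), pow_succ κ]
    field_simp

theorem integral_besselJ_term_mul_zernikeRadial (m : ℤ) (l j : ℕ) (x : ℝ) :
    ∫ ρ in (0 : ℝ)..1, (-1 : ℝ) ^ j / ((j.factorial : ℝ) * ((j + m.natAbs).factorial : ℝ)) *
        (x * ρ / 2) ^ (2 * j + m.natAbs) * (zernikeRadial (m.natAbs + 2 * l) m ρ * ρ)
      = (-1 : ℝ) ^ j * j.descFactorial l / (2 * j.factorial * (j + m.natAbs + l + 1).factorial) *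
          (x / 2) ^ (2 * j + m.natAbs) := by
  have hfactor : ∀ ρ : ℝ, (-1 : ℝ) ^ j / ((j.factorial : ℝ) * ((j + m.natAbs).factorial : ℝ)) *
        (x * ρ / 2) ^ (2 * j + m.natAbs) * (zernikeRadial (m.natAbs + 2 * l) m ρ * ρ)
      = (-1 : ℝ) ^ j / ((j.factorial : ℝ) * ((j + m.natAbs).factorial : ℝ)) *
          (x / 2) ^ (2 * j + m.natAbs) *
          (ρ ^ (2 * j + m.natAbs) * (zernikeRadial (m.natAbs + 2 * l) m ρ * ρ)) := fun ρ => by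
    rw [mul_div_right_comm, mul_pow]; ring
  simp_rw [hfactor]
  rw [intervalIntegral.integral_const_mul, integral_pow_mul_zernikeRadial]
  field_simp

theorem hasSum_integral_besselJ_term_mul {g : ℝ → ℝ} (hg : Continuous g) (q : ℕ) (x : ℝ) :
    HasSum (fun j : ℕ => ∫ ρ in (0 : ℝ)..1,
        (-1 : ℝ) ^ j / ((j.factorial : ℝ) * ((j + q).factorial : ℝ)) *
          (x * ρ / 2) ^ (2 * j + q) * g ρ)
      (∫ ρ in (0 : ℝ)..1, besselJ q (x * ρ) * g ρ) := by
  obtain ⟨M, hM⟩ := isCompact_Icc.exists_bound_of_continuousOn (s := Icc (0 : ℝ) 1) hg.continuousOn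
  refine intervalIntegral.hasSum_integral_of_dominated_convergence
    (fun j _ => |x / 2| ^ (2 * j + q) / (j.factorial * (j + q).factorial) * M)
    (fun j => Continuous.aestronglyMeasurable (by fun_prop)) (fun j => .of_forall fun ρ hρ => ?_)
    (.of_forall fun ρ _ => (summable_besselJ_bound q x).mul_right M) intervalIntegrable_const
    (.of_forall fun ρ _ => (hasSum_besselJ q (x * ρ)).mul_right _)
  rw [uIoc_of_le zero_le_one] at hρ
  rw [norm_mul, norm_besselJ_term, mul_div_right_comm, abs_mul, abs_of_pos hρ.1]
  gcongr
  · exact mul_nonneg (abs_nonneg _) hρ.1.le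
  · exact mul_le_of_le_one_right (abs_nonneg _) hρ.2
  · exact hM ρ (Ioc_subset_Icc_self hρ)

/-- The radial Zernike polynomials are orthogonal to `ρ^(|m| + 2j)` for `j < l`, so the termwise
integrals start at `j = l`; shifted by `l` they form the series of `J_{n+1}(πκ)/κ`. -/
theorem integral_besselJ_mul_zernikeRadial (m : ℤ) (l : ℕ) (κ : ℝ) :
    ∫ ρ in (0 : ℝ)..1, besselJ m.natAbs (π * κ * ρ) * (zernikeRadial (m.natAbs + 2 * l) m ρ * ρ)
      = (-1) ^ l * besselQuotient (m.natAbs + 2 * l) κ / π := by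
  have hcont : Continuous fun ρ => zernikeRadial (m.natAbs + 2 * l) m ρ * ρ :=
    (continuous_zernikeRadial _ m).mul continuous_id'
  have hterms := hasSum_integral_besselJ_term_mul hcont m.natAbs (π * κ)
  simp_rw [integral_besselJ_term_mul_zernikeRadial] at hterms
  have hquot := ((hasSum_besselQuotient (m.natAbs + 2 * l) κ).mul_left ((-1) ^ l)).div_const π
  refine hterms.unique (((add_left_injective l).hasSum_iff fun j hj => ?_).1
    (hquot.congr_fun fun i => ?_))
  · have hjl : j < l := not_le.1 fun h => hj ⟨j - l, Nat.sub_add_cancel h⟩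
    rw [Nat.descFactorial_of_lt hjl, Nat.cast_zero, mul_zero, zero_div, zero_mul]
  · have hdesc : ((i + l).descFactorial l : ℝ) = (i + l).factorial / i.factorial := by
      rw [eq_div_iff (by positivity), mul_comm]
      have := Nat.factorial_mul_descFactorial (Nat.le_add_left l i)
      rw [Nat.add_sub_cancel] at this
      exact_mod_cast this
    simp only [Function.comp_apply, hdesc]
    rw [show i + l + m.natAbs + l + 1 = i + (m.natAbs + 2 * l + 1) by ring,
      show 2 * (i + l) + m.natAbs = 2 * i + (m.natAbs + 2 * l) by ring,
      show π * κ / 2 = π / 2 * κ by ring, mul_pow, pow_add (-1 : ℝ) i l,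
      ← add_assoc (2 * i) (m.natAbs + 2 * l) 1, pow_succ (π / 2)]
    field_simp

/-! ### The Jacobi–Anger expansion -/

theorem hasSum_pow_div_factorial_mul (z w : ℂ) :
    HasSum (fun pq : ℕ × ℕ => z ^ pq.1 / pq.1.factorial * (w ^ pq.2 / pq.2.factorial))
      (Complex.exp (z + w)) := by
  let e (z : ℂ) (p : ℕ) : ℂ := z ^ p / p.factorial
  have hexp : ∀ z : ℂ, HasSum (e z) (Complex.exp z) := fun z => by
    rw [Complex.exp_eq_exp_ℂ]; exact NormedSpace.expSeries_div_hasSum_exp z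
  have hnorm : ∀ z : ℂ, Summable fun p => ‖e z p‖ := NormedSpace.norm_expSeries_div_summable
  rw [Complex.exp_add]
  exact HasSum.mul (f := e z) (g := e w) (hexp z) (hexp w)
    (summable_mul_of_summable_norm (f := e z) (g := e w) (hnorm z) (hnorm w))

theorem integral_exp_term (A B : ℂ) (m : ℤ) (p q : ℕ) :
    ∫ θ in (0 : ℝ)..(2 * π), (A * Complex.exp (-(Complex.I * θ))) ^ p / p.factorial *
        ((B * Complex.exp (Complex.I * θ)) ^ q / q.factorial) * Complex.exp (-(Complex.I * m * θ))
      = if (q : ℤ) - p - m = 0 then A ^ p / p.factorial * (B ^ q / q.factorial) * (2 * π)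
        else 0 := by
  have hterm : ∀ θ : ℝ, (A * Complex.exp (-(Complex.I * θ))) ^ p / p.factorial *
      ((B * Complex.exp (Complex.I * θ)) ^ q / q.factorial) * Complex.exp (-(Complex.I * m * θ))
      = A ^ p / p.factorial * (B ^ q / q.factorial) *
        Complex.exp (Complex.I * (((q : ℤ) - p - m : ℤ) : ℂ) * θ) := fun θ => by
    have hexp : Complex.exp (Complex.I * (((q : ℤ) - p - m : ℤ) : ℂ) * θ) =
        Complex.exp (p * -(Complex.I * θ)) * Complex.exp (q * (Complex.I * θ)) *
        Complex.exp (-(Complex.I * m * θ)) := by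
      rw [← Complex.exp_add, ← Complex.exp_add]; push_cast; ring_nf
    rw [mul_pow, mul_pow, ← Complex.exp_nat_mul, ← Complex.exp_nat_mul, hexp]
    ring
  have hint := integral_exp_int_mul ((q : ℤ) - p - m) 0
  rw [zero_add] at hint
  simp_rw [hterm]
  rw [intervalIntegral.integral_const_mul, hint, mul_ite, mul_zero]

theorem hasSum_integral_exp_mul_exp (A B : ℂ) (m : ℤ) :
    HasSum (fun pq : ℕ × ℕ => if (pq.2 : ℤ) - pq.1 - m = 0 then
        A ^ pq.1 / pq.1.factorial * (B ^ pq.2 / pq.2.factorial) * (2 * π : ℂ) else 0)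
      (∫ θ in (0 : ℝ)..(2 * π), Complex.exp (A * Complex.exp (-(Complex.I * θ)) +
        B * Complex.exp (Complex.I * θ)) * Complex.exp (-(Complex.I * m * θ))) := by
  have hsum : ∀ z : ℂ, Summable fun p : ℕ => ‖z ^ p / (p.factorial : ℂ)‖ :=
    NormedSpace.norm_expSeries_div_summable
  have hnorm : ∀ θ : ℝ, ‖Complex.exp (Complex.I * θ)‖ = 1 := fun θ => by
    rw [mul_comm]; exact Complex.norm_exp_ofReal_mul_I θ
  have hnorm_neg : ∀ θ : ℝ, ‖Complex.exp (-(Complex.I * θ))‖ = 1 := fun θ => by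
    simpa only [Complex.ofReal_neg, mul_neg] using hnorm (-θ)
  have hnorm_int : ∀ θ : ℝ, ‖Complex.exp (-(Complex.I * m * θ))‖ = 1 := fun θ => by
    simpa only [Complex.ofReal_mul, Complex.ofReal_intCast, mul_assoc] using hnorm_neg (m * θ)
  simp_rw [← integral_exp_term]
  refine intervalIntegral.hasSum_integral_of_dominated_convergence
    (fun pq _ => ‖A ^ pq.1 / pq.1.factorial‖ * ‖B ^ pq.2 / pq.2.factorial‖)
    (fun pq => Continuous.aestronglyMeasurable (by fun_prop))
    (fun pq => .of_forall fun θ _ => le_of_eq ?_) (.of_forall fun _ _ => ?_)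
    intervalIntegrable_const (.of_forall fun θ _ => (hasSum_pow_div_factorial_mul _ _).mul_right _)
  · simp only [norm_mul, norm_div, norm_pow, hnorm, hnorm_neg, hnorm_int, mul_one]
  · exact (hsum A).mul_of_nonneg (hsum B) (fun _ => norm_nonneg _) fun _ => norm_nonneg _

theorem factorial_add_toNat_mul_factorial (m : ℤ) (j : ℕ) :
    (j + (-m).toNat).factorial * (j + m.toNat).factorial
      = j.factorial * (j + m.natAbs).factorial := by
  rcases le_total 0 m with hm | hm
  · rw [Int.toNat_of_nonpos (neg_nonpos.2 hm), show m.toNat = m.natAbs by lia, add_zero]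
  · rw [Int.toNat_of_nonpos hm, show (-m).toNat = m.natAbs by lia, add_zero, mul_comm]

theorem I_mul_exp_pow_mul_pow (z : ℂ) (Φ : ℝ) (m : ℤ) (j : ℕ) :
    (Complex.I * z * Complex.exp (Complex.I * Φ)) ^ (j + (-m).toNat) *
        (Complex.I * z * Complex.exp (-(Complex.I * Φ))) ^ (j + m.toNat)
      = Complex.I ^ m.natAbs * ((-1) ^ j * z ^ (2 * j + m.natAbs)) *
        Complex.exp (-(Complex.I * m * Φ)) := by
  have hdiff : (m : ℂ) = m.toNat - (-m).toNat := by exact_mod_cast m.toNat_sub_toNat_neg.symm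
  have hexp : Complex.exp (-(Complex.I * m * Φ)) =
      Complex.exp ((j + (-m).toNat : ℕ) * (Complex.I * Φ)) *
        Complex.exp ((j + m.toNat : ℕ) * -(Complex.I * Φ)) := by
    rw [← Complex.exp_add, hdiff]; push_cast; ring_nf
  rw [hexp, mul_pow (_ * _), mul_pow (_ * _), ← Complex.exp_nat_mul, ← Complex.exp_nat_mul,
    ← Int.toNat_add_toNat_neg_eq_natAbs, ← Complex.I_sq]
  ring

/-- The Jacobi–Anger expansion: in the double exponential series only the terms with indices
`(j + m⁻, j + m⁺)` survive the integration, and they sum to the Bessel series. -/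
theorem integral_exp_cos_mul_exp (s Φ : ℝ) (m : ℤ) :
    ∫ θ in (0 : ℝ)..(2 * π), Complex.exp (Complex.I * (s * cos (θ - Φ) : ℝ)) *
        Complex.exp (-(Complex.I * m * θ))
      = 2 * π * Complex.I ^ m.natAbs * Complex.exp (-(Complex.I * m * Φ)) *
        besselJ m.natAbs s := by
  set A : ℂ := Complex.I * (s / 2) * Complex.exp (Complex.I * Φ) with hA
  set B : ℂ := Complex.I * (s / 2) * Complex.exp (-(Complex.I * Φ)) with hB
  have hcos : ∀ θ : ℝ, Complex.exp (Complex.I * (s * cos (θ - Φ) : ℝ)) =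
      Complex.exp (A * Complex.exp (-(Complex.I * θ)) + B * Complex.exp (Complex.I * θ)) := by
    intro θ
    rw [hA, hB, mul_assoc, mul_assoc _ _ (Complex.exp (Complex.I * θ)), ← Complex.exp_add,
      ← Complex.exp_add, Complex.ofReal_mul, Complex.ofReal_cos, Complex.cos]
    push_cast
    ring_nf
  have hinj : Function.Injective fun j : ℕ => (j + (-m).toNat, j + m.toNat) := fun i j h =>
    add_right_cancel (Prod.ext_iff.1 h).1
  simp_rw [hcos]
  refine (hasSum_integral_exp_mul_exp A B m).unique ((hinj.hasSum_iff fun pq hpq => ?_).1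
    (((Complex.hasSum_ofReal.2 (hasSum_besselJ m.natAbs s)).mul_left
      (2 * π * Complex.I ^ m.natAbs * Complex.exp (-(Complex.I * m * Φ)))).congr_fun fun j => ?_))
  · refine if_neg fun h => hpq ⟨pq.1 - (-m).toNat, Prod.ext ?_ ?_⟩ <;> lia
  · have hfact := congrArg (Nat.cast (R := ℂ)) (factorial_add_toNat_mul_factorial m j)
    push_cast at hfact
    simp only [Function.comp_apply]
    rw [if_pos (by lia), div_mul_div_comm, I_mul_exp_pow_mul_pow, hfact]
    push_cast
    ring

/-! ### Fourier–Zernike coefficients of the exponentials -/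

/-- The exponential of frequency `k` on the square `[-a, a]²`, whose conjugates are the characters
in `squareFourierCoeff`. -/
noncomputable def squareMonomial (a : ℝ) (k : ℤ × ℤ) (x : ℝ × ℝ) : ℂ :=
  Complex.exp (π * Complex.I * (a : ℂ)⁻¹ * (k.1 * x.1 + k.2 * x.2))

theorem latticeNorm_mul_cos_sub_latticeAngle (k : ℤ × ℤ) (θ : ℝ) :
    latticeNorm k * cos (θ - latticeAngle k) = k.1 * cos θ + k.2 * sin θ := by
  set z : ℂ := ⟨k.1, k.2⟩
  have hnorm : latticeNorm k = ‖z‖ := by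
    rw [Complex.norm_def, Complex.normSq_apply, latticeNorm, pow_two, pow_two]
  have hangle : latticeAngle k = z.arg - (toIcoDiv two_pi_pos 0 z.arg : ℤ) * (2 * π) := by
    rw [latticeAngle, ← self_sub_toIcoDiv_zsmul, zsmul_eq_mul]
  have hcos : cos (θ - latticeAngle k) = cos (θ - z.arg) := by
    rw [hangle, sub_sub_eq_add_sub, add_sub_right_comm]
    exact cos_add_int_mul_two_pi _ _
  rw [hcos, hnorm, cos_sub, mul_add, mul_left_comm, Complex.norm_mul_cos_arg, mul_left_comm,
    Complex.norm_mul_sin_arg, mul_comm, mul_comm (sin θ)]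

theorem squareMonomial_polar (a : ℝ) (k : ℤ × ℤ) (r θ : ℝ) :
    squareMonomial a k (r * cos θ, r * sin θ) = Complex.exp (Complex.I *
      ((π * latticeNorm k * (a⁻¹ * r)) * cos (θ - latticeAngle k) : ℝ)) := by
  rw [squareMonomial, mul_right_comm, mul_right_comm (_ * _) (_ * _), mul_assoc π,
    latticeNorm_mul_cos_sub_latticeAngle]
  push_cast
  ring_nf

theorem conj_fourierZernike (a : ℝ) (n : ℕ) (m : ℤ) (r θ : ℝ) :
    starRingEnd ℂ (fourierZernike a n m r θ)
      = ((a⁻¹ * √((n + 1) / π) * zernikeRadial n m (a⁻¹ * r) : ℝ) : ℂ) *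
        Complex.exp (-(Complex.I * m * θ)) := by
  rw [fourierZernike, map_mul, Complex.conj_ofReal, ← Complex.exp_conj]
  simp

theorem I_zpow_mul_neg_one_zpow (m : ℤ) (l : ℕ) :
    Complex.I ^ m * (-1 : ℂ) ^ ((((m.natAbs + 2 * l : ℕ) : ℤ) - m) / 2)
      = Complex.I ^ m.natAbs * (-1) ^ l := by
  rcases Int.natAbs_eq m with hm | hm
  · rw [show (((m.natAbs + 2 * l : ℕ) : ℤ) - m) / 2 = (l : ℤ) by lia, zpow_natCast,
      ← zpow_natCast Complex.I, ← hm]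
  · have hinv : (Complex.I ^ m.natAbs)⁻¹ * (-1) ^ m.natAbs = Complex.I ^ m.natAbs := by
      rw [← inv_pow, Complex.inv_I, ← mul_pow, mul_neg_one, neg_neg]
    rw [show (((m.natAbs + 2 * l : ℕ) : ℤ) - m) / 2 = ((m.natAbs + l : ℕ) : ℤ) by lia,
      zpow_natCast, pow_add, ← mul_assoc, show Complex.I ^ m = (Complex.I ^ m.natAbs)⁻¹ by
        conv_lhs => rw [hm, zpow_neg, zpow_natCast], hinv]

theorem integral_squareMonomial_mul_conj_fourierZernike (a : ℝ) (k : ℤ × ℤ) (n : ℕ) (m : ℤ)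
    (r : ℝ) :
    ∫ θ in (0 : ℝ)..(2 * π), squareMonomial a k (r * cos θ, r * sin θ) *
        starRingEnd ℂ (fourierZernike a n m r θ) * (r : ℂ)
      = 2 * π * Complex.I ^ m.natAbs * Complex.exp (-(Complex.I * m * latticeAngle k)) *
        ((√((n + 1) / π) * (besselJ m.natAbs (π * latticeNorm k * (a⁻¹ * r)) *
          (zernikeRadial n m (a⁻¹ * r) * (a⁻¹ * r))) : ℝ) : ℂ) := by
  have hfactor : ∀ θ : ℝ, squareMonomial a k (r * cos θ, r * sin θ) *
        starRingEnd ℂ (fourierZernike a n m r θ) * (r : ℂ) =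
      ((√((n + 1) / π) * (zernikeRadial n m (a⁻¹ * r) * (a⁻¹ * r)) : ℝ) : ℂ) *
        (Complex.exp (Complex.I *
          ((π * latticeNorm k * (a⁻¹ * r)) * cos (θ - latticeAngle k) : ℝ)) *
        Complex.exp (-(Complex.I * m * θ))) := fun θ => by
    rw [squareMonomial_polar, conj_fourierZernike]
    push_cast
    ring
  simp_rw [hfactor]
  rw [intervalIntegral.integral_const_mul, integral_exp_cos_mul_exp]
  push_cast
  ring

theorem zernikeCoeff_squareMonomial {a : ℝ} (ha : 0 < a) (k : ℤ × ℤ) (m : ℤ) (l : ℕ) :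
    zernikeCoeff a (m.natAbs + 2 * l) m (squareMonomial a k)
      = 4 * a ^ 2 * convFactor a k (m.natAbs + 2 * l) m := by
  have hradial : ∫ r in (0 : ℝ)..a, besselJ m.natAbs (π * latticeNorm k * (a⁻¹ * r)) *
      (zernikeRadial (m.natAbs + 2 * l) m (a⁻¹ * r) * (a⁻¹ * r))
      = a * ((-1) ^ l * besselQuotient (m.natAbs + 2 * l) (latticeNorm k) / π) := by
    rw [intervalIntegral.integral_comp_mul_left (fun ρ => besselJ m.natAbs (π * latticeNorm k * ρ) *
      (zernikeRadial (m.natAbs + 2 * l) m ρ * ρ)) (inv_ne_zero ha.ne'), mul_zero,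
      inv_mul_cancel₀ ha.ne', integral_besselJ_mul_zernikeRadial, inv_inv, smul_eq_mul]
  rw [zernikeCoeff]
  simp_rw [integral_squareMonomial_mul_conj_fourierZernike]
  rw [intervalIntegral.integral_const_mul, intervalIntegral.integral_ofReal,
    intervalIntegral.integral_const_mul, hradial, convFactor, I_zpow_mul_neg_one_zpow,
    sqrt_div (by positivity)]
  have hsqrt : ((√π : ℝ) : ℂ) ≠ 0 := by exact_mod_cast (sqrt_pos.2 pi_pos).ne'
  have hπ : (π : ℂ) ≠ 0 := by exact_mod_cast pi_ne_zero
  have ha' : (a : ℂ) ≠ 0 := by exact_mod_cast ha.ne'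
  push_cast
  field_simp
  ring

/-! ### The Fourier–Zernike functions in Cartesian coordinates -/

theorem polar_mem_disk_iff {a r : ℝ} (ha : 0 ≤ a) (hr : 0 ≤ r) (θ : ℝ) :
    (r * cos θ, r * sin θ) ∈ disk a ↔ r ≤ a := by
  rw [disk, mem_ofPred_eq, mul_pow, mul_pow, ← mul_add, cos_sq_add_sin_sq, mul_one,
    pow_le_pow_iff_left₀ hr ha two_ne_zero]

section PolarCoordinates

variable {E : Type*} [NormedAddCommGroup E] [NormedSpace ℝ E]

theorem integrableOn_smul_polarCoord_symm {g : ℝ × ℝ → E} (hg : Integrable g) :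
    IntegrableOn (fun p : ℝ × ℝ => p.1 • g (polarCoord.symm p)) polarCoord.target := by
  have hmeas : MeasurableSet polarCoord.target := polarCoord.open_target.measurableSet
  refine ((integrableOn_image_iff_integrableOn_abs_det_fderiv_smul volume hmeas
    (fun p _ => (hasFDerivAt_polarCoord_symm p).hasFDerivWithinAt) polarCoord.symm.injOn
    g).1 hg.integrableOn).congr_fun (fun p hp => ?_) hmeas
  simp only [det_fderivPolarCoordSymm, abs_of_pos (show 0 < p.1 from hp.1)]

theorem integral_indicator_disk_polar {a : ℝ} (ha : 0 ≤ a) (h : ℝ × ℝ → E) {r : ℝ} (hr : 0 ≤ r) :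
    ∫ θ in Ioo (-π) π, r • (disk a).indicator h (polarCoord.symm (r, θ))
      = (Iic a).indicator
          (fun r => ∫ θ in (0 : ℝ)..(2 * π), r • h (r * cos θ, r * sin θ)) r := by
  simp only [polarCoord_symm_apply]
  by_cases hra : r ≤ a
  · have hper : Function.Periodic (fun θ => r • h (r * cos θ, r * sin θ)) (2 * π) :=
      fun θ => by simp only [cos_add_two_pi, sin_add_two_pi]
    have hshift := hper.intervalIntegral_add_eq (-π) 0
    rw [zero_add, show -π + 2 * π = π by ring, integral_of_le (by linarith [pi_pos]),
      integral_Ioc_eq_integral_Ioo] at hshift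
    rw [indicator_of_mem (mem_Iic.2 hra), ← hshift]
    simp only [indicator_of_mem ((polar_mem_disk_iff ha hr _).2 hra)]
  · rw [indicator_of_notMem (notMem_Iic.2 (not_le.1 hra))]
    simp only [indicator_of_notMem (mt (polar_mem_disk_iff ha hr _).1 hra), smul_zero,
      integral_zero]

theorem setIntegral_disk_eq_polar {a : ℝ} (ha : 0 ≤ a) {h : ℝ × ℝ → E}
    (hh : IntegrableOn h (disk a)) :
    ∫ x in disk a, h x =
      ∫ r in (0 : ℝ)..a, ∫ θ in (0 : ℝ)..(2 * π), r • h (r * cos θ, r * sin θ) := by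
  have hdisk := measurableSet_disk a
  have hint := integrableOn_smul_polarCoord_symm ((integrable_indicator_iff hdisk).2 hh)
  rw [← MeasureTheory.integral_indicator hdisk, ← integral_comp_polarCoord_symm]
  rw [polarCoord_target] at hint ⊢
  rw [Measure.volume_eq_prod, setIntegral_prod _ hint, setIntegral_congr_fun measurableSet_Ioi
    fun r hr => integral_indicator_disk_polar ha h (le_of_lt hr),
    setIntegral_indicator measurableSet_Iic, Ioi_inter_Iic, integral_of_le ha]

end PolarCoordinates

/-- The conjugate of the Fourier–Zernike function `V_{nm}^a`, `n = |m| + 2l`, as a polynomial in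
the Cartesian coordinates. The factor `(r e^{-iθ})^m` is `(x - iy)^m` for `m ≥ 0` and
`(x + iy)^|m|` for `m ≤ 0`. -/
noncomputable def conjZernikePoly (a : ℝ) (m : ℤ) (l : ℕ) : MvPolynomial (Fin 2) ℂ :=
  ∑ i ∈ Finset.range (l + 1),
    MvPolynomial.C ((a⁻¹ * √(((m.natAbs + 2 * l : ℕ) + 1) / π) * ((-1) ^ (l + i) *
      ((m.natAbs + l + i).factorial / (i.factorial * (l - i).factorial *
        (m.natAbs + i).factorial)) * a⁻¹ ^ (m.natAbs + 2 * i)) : ℝ) : ℂ) *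
    ((MvPolynomial.X 0 ^ 2 + MvPolynomial.X 1 ^ 2) ^ i *
      ((MvPolynomial.X 0 - MvPolynomial.C Complex.I * MvPolynomial.X 1) ^ m.toNat *
        (MvPolynomial.X 0 + MvPolynomial.C Complex.I * MvPolynomial.X 1) ^ (-m).toNat))

/-- The conjugate of the Fourier–Zernike function `V_{nm}^a`, `n = |m| + 2l`, in Cartesian
coordinates. -/
noncomputable def conjZernike (a : ℝ) (m : ℤ) (l : ℕ) (z : ℝ × ℝ) : ℂ :=
  MvPolynomial.eval ![(z.1 : ℂ), (z.2 : ℂ)] (conjZernikePoly a m l)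

theorem continuous_conjZernike (a : ℝ) (m : ℤ) (l : ℕ) : Continuous (conjZernike a m l) :=
  continuous_eval_pair _

theorem exp_neg_int_mul_mul_pow_natAbs (m : ℤ) (r θ : ℝ) :
    Complex.exp (-(Complex.I * m * θ)) * (r : ℂ) ^ m.natAbs
      = ((r * cos θ : ℝ) - Complex.I * (r * sin θ : ℝ)) ^ m.toNat *
        ((r * cos θ : ℝ) + Complex.I * (r * sin θ : ℝ)) ^ (-m).toNat := by
  have hpos : ((r * cos θ : ℝ) + Complex.I * (r * sin θ : ℝ) : ℂ)
      = r * Complex.exp (θ * Complex.I) := by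
    rw [Complex.exp_mul_I]; push_cast; ring
  have hneg : ((r * cos θ : ℝ) - Complex.I * (r * sin θ : ℝ) : ℂ)
      = r * Complex.exp (-θ * Complex.I) := by
    rw [Complex.exp_mul_I, Complex.cos_neg, Complex.sin_neg]; push_cast; ring
  have hdiff : (m : ℂ) = m.toNat - (-m).toNat := by exact_mod_cast m.toNat_sub_toNat_neg.symm
  have hexp : Complex.exp (-(Complex.I * m * θ)) = Complex.exp (m.toNat * (-θ * Complex.I)) *
      Complex.exp ((-m).toNat * (θ * Complex.I)) := by
    rw [← Complex.exp_add, hdiff]; ring_nf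
  rw [hpos, hneg, mul_pow, mul_pow, ← Complex.exp_nat_mul, ← Complex.exp_nat_mul, hexp,
    ← Int.toNat_add_toNat_neg_eq_natAbs, pow_add]
  ring

theorem conjZernike_polar (a : ℝ) (m : ℤ) (l : ℕ) (r θ : ℝ) :
    conjZernike a m l (r * cos θ, r * sin θ)
      = starRingEnd ℂ (fourierZernike a (m.natAbs + 2 * l) m r θ) := by
  have hradius : (((r * cos θ : ℝ) : ℂ) ^ 2 + ((r * sin θ : ℝ) : ℂ) ^ 2) = (r : ℂ) ^ 2 := by
    rw [← Complex.ofReal_pow, ← Complex.ofReal_pow, ← Complex.ofReal_add, mul_pow, mul_pow,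
      ← mul_add, cos_sq_add_sin_sq, mul_one, Complex.ofReal_pow]
  rw [conj_fourierZernike, zernikeRadial_natAbs_add_two_mul, conjZernike, conjZernikePoly, map_sum,
    Finset.mul_sum, Complex.ofReal_sum, Finset.sum_mul]
  refine Finset.sum_congr rfl fun i _ => ?_
  simp only [map_mul, map_pow, map_add, map_sub, MvPolynomial.eval_C, MvPolynomial.eval_X,
    Matrix.cons_val_zero, Matrix.cons_val_one]
  rw [hradius, ← exp_neg_int_mul_mul_pow_natAbs]
  push_cast
  ring

theorem zernikeCoeff_eq_setIntegral {a : ℝ} (ha : 0 ≤ a) (m : ℤ) (l : ℕ) {f : ℝ × ℝ → ℂ}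
    (hf : IntegrableOn f (disk a)) :
    zernikeCoeff a (m.natAbs + 2 * l) m f = ∫ z in disk a, f z * conjZernike a m l z := by
  have hcompact : IsCompact (disk a) := Metric.isCompact_of_isClosed_isBounded
    (isClosed_le (by fun_prop) (by fun_prop)) (isBounded_disk ha)
  rw [setIntegral_disk_eq_polar ha
    (hf.mul_continuousOn (continuous_conjZernike a m l).continuousOn hcompact), zernikeCoeff]
  simp only [conjZernike_polar, Complex.real_smul, mul_comm]

/-! ### Square partial sums of the Fourier–Zernike functions -/

theorem continuous_squareMonomial (a : ℝ) (k : ℤ × ℤ) : Continuous (squareMonomial a k) := by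
  unfold squareMonomial; fun_prop

theorem norm_squareMonomial (a : ℝ) (k : ℤ × ℤ) (x : ℝ × ℝ) : ‖squareMonomial a k x‖ = 1 := by
  have hreal : (π * Complex.I * (a : ℂ)⁻¹ * (k.1 * x.1 + k.2 * x.2) : ℂ) =
      ((π * a⁻¹ * (k.1 * x.1 + k.2 * x.2) : ℝ) : ℂ) * Complex.I := by push_cast; ring
  rw [squareMonomial, hreal, Complex.norm_exp_ofReal_mul_I]

theorem setIntegral_squareMonomial_mul_conjZernike {a : ℝ} (ha : 0 < a) (k : ℤ × ℤ) (m : ℤ)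
    (l : ℕ) :
    ∫ z in disk a, squareMonomial a k z * conjZernike a m l z
      = 4 * a ^ 2 * convFactor a k (m.natAbs + 2 * l) m := by
  rw [← zernikeCoeff_squareMonomial ha, zernikeCoeff_eq_setIntegral ha.le]
  exact integrableOn_of_isBounded (continuous_squareMonomial a k) (isBounded_disk ha.le)

/-- The `N`-th square partial sum of the Fourier series on `[-a, a]²` of the conjugate
Fourier–Zernike function cut off outside `disk a`. -/
noncomputable def zernikePartialSum (a : ℝ) (n : ℕ) (m : ℤ) (N : ℕ) (x : ℝ × ℝ) : ℂ :=
  ∑ k ∈ latticeSquare N, convFactor a k n m * squareMonomial a (-k) x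

theorem sum_squareMonomial_mul (a : ℝ) (N : ℕ) (x z : ℝ × ℝ) :
    ∑ k ∈ latticeSquare N, squareMonomial a k z * squareMonomial a (-k) x =
      squareDirichletKernel N ((π / a) • x) ((π / a) • z) := by
  simp only [squareDirichletKernel, Prod.smul_fst, Prod.smul_snd, smul_eq_mul]
  rw [← dirichletKernel_neg N (π / a * x.1 - π / a * z.1),
    ← dirichletKernel_neg N (π / a * x.2 - π / a * z.2), Complex.ofReal_mul,
    dirichletKernel_eq_sum_exp, dirichletKernel_eq_sum_exp, Finset.sum_mul_sum, latticeSquare,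
    Finset.sum_product]
  refine Finset.sum_congr rfl fun i _ => Finset.sum_congr rfl fun j _ => ?_
  simp only [squareMonomial, ← Complex.exp_add, Prod.neg_mk]
  congr 1; push_cast; ring

theorem zernikePartialSum_eq_setIntegral {a : ℝ} (ha : 0 < a) (m : ℤ) (l N : ℕ) (x : ℝ × ℝ) :
    zernikePartialSum a (m.natAbs + 2 * l) m N x = (4 * a ^ 2 : ℂ)⁻¹ * ∫ z in disk a,
      squareDirichletKernel N ((π / a) • x) ((π / a) • z) • conjZernike a m l z := by
  have ha' : (a : ℂ) ≠ 0 := by exact_mod_cast ha.ne'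
  simp_rw [Complex.real_smul, ← sum_squareMonomial_mul, Finset.sum_mul]
  rw [MeasureTheory.integral_finsetSum _ fun k _ => integrableOn_of_isBounded
    (((continuous_squareMonomial a k).fun_mul continuous_const).fun_mul
      (continuous_conjZernike a m l)) (isBounded_disk ha.le), Finset.mul_sum, zernikePartialSum]
  refine Finset.sum_congr rfl fun k _ => ?_
  simp_rw [mul_right_comm _ (squareMonomial a (-k) x)]
  rw [MeasureTheory.integral_mul_const, setIntegral_squareMonomial_mul_conjZernike ha]
  field_simp

open scoped Pointwise in
theorem smul_disk {s : ℝ} (hs : 0 < s) (r : ℝ) : s • disk r = disk (s * r) := by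
  ext z
  rw [mem_smul_set_iff_inv_smul_mem₀ hs.ne']
  simp only [disk, mem_ofPred_eq, Prod.smul_fst, Prod.smul_snd, smul_eq_mul, mul_pow]
  rw [← mul_add, inv_pow, inv_mul_le_iff₀ (by positivity)]

theorem setIntegral_disk_eq_setIntegral_disk_pi {E : Type*} [NormedAddCommGroup E]
    [NormedSpace ℝ E] {a : ℝ} (ha : 0 < a) (h : ℝ × ℝ → E) :
    ∫ z in disk a, h z = (a / π) ^ 2 • ∫ z in disk π, h ((a / π) • z) := by
  have hs : 0 < a / π := by positivity
  rw [Measure.setIntegral_comp_smul_of_pos _ _ _ hs, smul_disk hs, div_mul_cancel₀ _ pi_ne_zero,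
    Module.finrank_prod, Module.finrank_self, smul_inv_smul₀ (by positivity)]

theorem eval_aeval_C_mul_X (P : MvPolynomial (Fin 2) ℂ) (s : ℝ) (z : ℝ × ℝ) :
    MvPolynomial.eval ![(z.1 : ℂ), (z.2 : ℂ)]
        (MvPolynomial.aeval (fun i => MvPolynomial.C (s : ℂ) * MvPolynomial.X i) P)
      = MvPolynomial.eval ![((s • z).1 : ℂ), ((s • z).2 : ℂ)] P := by
  rw [← MvPolynomial.coe_aeval_eq_eval, ← MvPolynomial.coe_aeval_eq_eval, RingHom.coe_coe,
    RingHom.coe_coe, ← AlgHom.comp_apply, MvPolynomial.comp_aeval]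
  congr 2
  funext i
  fin_cases i <;> simp

theorem exists_norm_zernikePartialSum_le {a : ℝ} (ha : 0 < a) (m : ℤ) (l : ℕ) :
    ∃ C, ∀ (N : ℕ) (x : ℝ × ℝ), |x.1| ≤ a → |x.2| ≤ a →
      ‖zernikePartialSum a (m.natAbs + 2 * l) m N x‖ ≤ C := by
  obtain ⟨C, hC⟩ := hasBoundedPartialSums_disk_eval (MvPolynomial.aeval
    (fun i => MvPolynomial.C ((a / π : ℝ) : ℂ) * MvPolynomial.X i) (conjZernikePoly a m l))
  have hrescale : ∀ t : ℝ, |t| ≤ a → |π / a * t| ≤ π := fun t ht => by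
    rw [abs_mul, abs_of_pos (by positivity), div_mul_eq_mul_div, div_le_iff₀ ha]
    gcongr
  have hcancel : π / a * (a / π) = 1 := by field_simp
  refine ⟨‖(4 * a ^ 2 : ℂ)⁻¹‖ * ((a / π) ^ 2 * C), fun N x hx₁ hx₂ => ?_⟩
  rw [zernikePartialSum_eq_setIntegral ha, setIntegral_disk_eq_setIntegral_disk_pi ha, norm_mul,
    norm_smul, norm_eq_abs, abs_of_nonneg (by positivity)]
  simp_rw [smul_smul, hcancel, one_smul, conjZernike, ← eval_aeval_C_mul_X]
  gcongr
  exact hC N _ (hrescale _ hx₁) (hrescale _ hx₂)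

/-! ### The period square and the torus -/

section Torus

-- As in Mathlib's treatment of `UnitAddTorus.mFourier`, the torus carries its probability measure.
noncomputable local instance unitAddCircleMeasureSpace : MeasureSpace UnitAddCircle :=
  ⟨AddCircle.haarAddCircle⟩

local instance unitAddCircleIsProbabilityMeasure :
    IsProbabilityMeasure (volume : Measure UnitAddCircle) :=
  inferInstanceAs (IsProbabilityMeasure AddCircle.haarAddCircle)

/-- The half-open square `(-a, a]²`, a fundamental domain for the Fourier series. -/
def periodSquare (a : ℝ) : Set (ℝ × ℝ) := Ioc (-a) a ×ˢ Ioc (-a) a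

theorem measurableSet_periodSquare (a : ℝ) : MeasurableSet (periodSquare a) :=
  measurableSet_Ioc.prod measurableSet_Ioc

theorem isBounded_periodSquare (a : ℝ) : Bornology.IsBounded (periodSquare a) :=
  (Metric.isBounded_Ioc _ _).prod (Metric.isBounded_Ioc _ _)

/-- The projection of the plane onto the torus with fundamental domain `periodSquare a`. -/
noncomputable def torusProj (a : ℝ) (x : ℝ × ℝ) : UnitAddTorus (Fin 2) :=
  ![(((2 * a)⁻¹ * x.1 : ℝ) : UnitAddCircle), (((2 * a)⁻¹ * x.2 : ℝ) : UnitAddCircle)]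

/-- The section of `torusProj a` with values in `periodSquare a`. -/
noncomputable def torusSection (a : ℝ) (θ : UnitAddTorus (Fin 2)) : ℝ × ℝ :=
  (2 * a * (AddCircle.measurableEquivIoc 1 (-1 / 2) (θ 0) : ℝ),
    2 * a * (AddCircle.measurableEquivIoc 1 (-1 / 2) (θ 1) : ℝ))

theorem inv_two_mul_mul_mem_Ioc_iff {a t : ℝ} (ha : 0 < a) :
    (2 * a)⁻¹ * t ∈ Ioc (-1 / 2 : ℝ) (-1 / 2 + 1) ↔ t ∈ Ioc (-a) a := by
  rw [inv_mul_eq_div, mem_Ioc, mem_Ioc, lt_div_iff₀ (by positivity), div_le_iff₀ (by positivity)]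
  ring_nf

theorem measurable_torusSection (a : ℝ) : Measurable (torusSection a) := by
  have hcoord : ∀ i : Fin 2, Measurable fun θ : UnitAddTorus (Fin 2) =>
      (AddCircle.measurableEquivIoc 1 (-1 / 2) (θ i) : ℝ) := fun i =>
    measurable_subtype_coe.comp
      ((AddCircle.measurableEquivIoc 1 (-1 / 2)).measurable.comp (measurable_pi_apply i))
  exact ((hcoord 0).const_mul _).prodMk ((hcoord 1).const_mul _)

theorem torusSection_torusProj {a : ℝ} (ha : 0 < a) {x : ℝ × ℝ} (hx : x ∈ periodSquare a) :
    torusSection a (torusProj a x) = x := by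
  have hcoord : ∀ t ∈ Ioc (-a) a, 2 * a *
      (AddCircle.equivIoc 1 (-1 / 2) (((2 * a)⁻¹ * t : ℝ) : UnitAddCircle) : ℝ) = t :=
    fun t ht => by
      rw [AddCircle.equivIoc_coe_eq ((inv_two_mul_mul_mem_Ioc_iff ha).2 ht)]
      field_simp
  exact Prod.ext (hcoord _ hx.1) (hcoord _ hx.2)

theorem measurePreserving_inv_smul_periodSquare {a : ℝ} (ha : 0 < a) :
    MeasurePreserving (fun x : ℝ × ℝ => (2 * a)⁻¹ • x) (volume.restrict (periodSquare a))
      (ENNReal.ofReal (4 * a ^ 2) • (volume.restrict (Ioc (-1 / 2 : ℝ) (-1 / 2 + 1) ×ˢ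
        Ioc (-1 / 2 : ℝ) (-1 / 2 + 1)))) := by
  have hscale : MeasurePreserving (fun x : ℝ × ℝ => (2 * a)⁻¹ • x) volume
      (ENNReal.ofReal (4 * a ^ 2) • volume) := by
    refine ⟨measurable_const_smul _, ?_⟩
    rw [Measure.map_addHaar_smul _ (by positivity), Module.finrank_prod, Module.finrank_self,
      inv_pow, inv_inv, abs_of_nonneg (by positivity)]
    congr 2; ring
  have hpre : (fun x : ℝ × ℝ => (2 * a)⁻¹ • x) ⁻¹' (Ioc (-1 / 2 : ℝ) (-1 / 2 + 1) ×ˢ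
        Ioc (-1 / 2 : ℝ) (-1 / 2 + 1)) = periodSquare a := by
    ext x
    simp only [periodSquare, mem_preimage, mem_prod, Prod.smul_fst, Prod.smul_snd, smul_eq_mul,
      inv_two_mul_mul_mem_Ioc_iff ha]
  rw [← hpre, ← Measure.restrict_smul]
  exact hscale.restrict_preimage (measurableSet_Ioc.prod measurableSet_Ioc)

theorem measurePreserving_torusProj {a : ℝ} (ha : 0 < a) :
    MeasurePreserving (torusProj a) (volume.restrict (periodSquare a))
      (ENNReal.ofReal (4 * a ^ 2) • volume) := by
  have hcircle : MeasurePreserving (fun t : ℝ => (t : UnitAddCircle))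
      (volume.restrict (Ioc (-1 / 2 : ℝ) (-1 / 2 + 1))) volume := by
    have h := UnitAddCircle.measurePreserving_mk (-1 / 2)
    rwa [AddCircle.volume_eq_smul_haarAddCircle, ENNReal.ofReal_one, one_smul] at h
  have htorus := (volume_preserving_finTwoArrow UnitAddCircle).symm.comp (hcircle.prod hcircle)
  rw [Measure.prod_restrict, ← Measure.volume_eq_prod] at htorus
  exact (htorus.smul_measure _).comp (measurePreserving_inv_smul_periodSquare ha)

theorem measurePreserving_torusSection {a : ℝ} (ha : 0 < a) :
    MeasurePreserving (torusSection a) (ENNReal.ofReal (4 * a ^ 2) • volume)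
      (volume.restrict (periodSquare a)) := by
  have hproj := measurePreserving_torusProj ha
  refine ⟨measurable_torusSection a, ?_⟩
  rw [← hproj.map_eq, Measure.map_map (measurable_torusSection a) hproj.measurable]
  conv_rhs => rw [← Measure.map_id (μ := volume.restrict (periodSquare a))]
  exact Measure.map_congr (ae_restrict_of_forall_mem (measurableSet_periodSquare a)
    fun x hx => torusSection_torusProj ha hx)

theorem setIntegral_comp_torusProj {E : Type*} [NormedAddCommGroup E] [NormedSpace ℝ E] {a : ℝ}
    (ha : 0 < a) {F : UnitAddTorus (Fin 2) → E} (hF : AEStronglyMeasurable F) :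
    ∫ x in periodSquare a, F (torusProj a x) = (4 * a ^ 2) • ∫ θ, F θ := by
  have hproj := measurePreserving_torusProj ha
  rw [← integral_map hproj.measurable.aemeasurable (hproj.map_eq ▸ hF.smul_measure _),
    hproj.map_eq, MeasureTheory.integral_smul_measure, ENNReal.toReal_ofReal (by positivity)]

theorem memLp_comp_torusSection {E : Type*} [NormedAddCommGroup E] {a : ℝ} (ha : 0 < a)
    {p : ENNReal} {f : ℝ × ℝ → E} (hf : MemLp f p (volume.restrict (periodSquare a))) :
    MemLp (f ∘ torusSection a) p := by
  have hscaled := hf.comp_measurePreserving (measurePreserving_torusSection ha)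
  have hc : ENNReal.ofReal (4 * a ^ 2) ≠ 0 := (ENNReal.ofReal_pos.2 (by positivity)).ne'
  refine hscaled.of_measure_le_smul (c := (ENNReal.ofReal (4 * a ^ 2))⁻¹)
    (ENNReal.inv_ne_top.2 hc) ?_
  rw [smul_smul, ENNReal.inv_mul_cancel hc ENNReal.ofReal_ne_top, one_smul]

theorem mFourier_torusProj (a : ℝ) (n : Fin 2 → ℤ) (x : ℝ × ℝ) :
    UnitAddTorus.mFourier n (torusProj a x) = squareMonomial a (n 0, n 1) x := by
  simp only [UnitAddTorus.mFourier, ContinuousMap.coe_mk, Fin.prod_univ_two, torusProj,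
    Matrix.cons_val_zero, Matrix.cons_val_one, squareMonomial]
  rw [fourier_coe_apply, fourier_coe_apply, ← Complex.exp_add]
  congr 1
  push_cast
  ring

theorem setIntegral_comp_torusProj_mul_squareMonomial {a : ℝ} (ha : 0 < a)
    {F : UnitAddTorus (Fin 2) → ℂ} (hF : AEStronglyMeasurable F) (k : ℤ × ℤ) :
    ∫ x in periodSquare a, F (torusProj a x) * squareMonomial a (-k) x
      = 4 * a ^ 2 * UnitAddTorus.mFourierCoeff F ![k.1, k.2] := by
  have hmonomial : ∀ x, squareMonomial a (-k) x =
      UnitAddTorus.mFourier (-![k.1, k.2]) (torusProj a x) := fun x => by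
    rw [mFourier_torusProj]; rfl
  simp_rw [hmonomial, mul_comm (F _)]
  rw [setIntegral_comp_torusProj ha (F := fun θ => UnitAddTorus.mFourier (-![k.1, k.2]) θ * F θ)
    ((map_continuous _).aestronglyMeasurable.mul hF), Complex.real_smul]
  push_cast
  rfl

theorem setIntegral_squareMonomial_mul_neg {a : ℝ} (ha : 0 < a) (k l : ℤ × ℤ) :
    ∫ x in periodSquare a, squareMonomial a k x * squareMonomial a (-l) x =
      if l = k then (4 * a ^ 2 : ℂ) else 0 := by
  have horth := orthonormal_iff_ite.1 (UnitAddTorus.orthonormal_mFourier (d := Fin 2))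
    ![l.1, l.2] ![k.1, k.2]
  have hcoef : UnitAddTorus.mFourierCoeff (UnitAddTorus.mFourier ![k.1, k.2]) ![l.1, l.2]
      = if l = k then 1 else 0 := by
    rw [ContinuousMap.inner_toLp] at horth
    simp_rw [UnitAddTorus.mFourierCoeff, UnitAddTorus.mFourier_neg, smul_eq_mul, mul_comm, horth]
    simp [Prod.ext_iff]
  have hmonomial : ∀ x, squareMonomial a k x =
      UnitAddTorus.mFourier ![k.1, k.2] (torusProj a x) := fun x => by
    rw [mFourier_torusProj]; rfl
  simp_rw [hmonomial]
  rw [setIntegral_comp_torusProj_mul_squareMonomial ha (map_continuous _).aestronglyMeasurable,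
    hcoef, mul_ite, mul_one, mul_zero]

theorem summable_sq_norm_setIntegral_mul_squareMonomial {a : ℝ} (ha : 0 < a) {f : ℝ × ℝ → ℂ}
    (hf : MemLp f 2 (volume.restrict (periodSquare a))) :
    Summable fun k : ℤ × ℤ => ‖∫ x in periodSquare a, f x * squareMonomial a (-k) x‖ ^ 2 := by
  have hF := memLp_comp_torusSection ha hf
  have hcoef : ∀ k : ℤ × ℤ, ∫ x in periodSquare a, f x * squareMonomial a (-k) x =
      4 * a ^ 2 * UnitAddTorus.mFourierCoeff (hF.toLp _) ![k.1, k.2] := fun k => by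
    rw [UnitAddTorus.mFourierCoeff, MeasureTheory.integral_congr_ae
      (hF.coeFn_toLp.mono fun θ hθ => by rw [hθ])]
    rw [← UnitAddTorus.mFourierCoeff,
      ← setIntegral_comp_torusProj_mul_squareMonomial ha hF.aestronglyMeasurable]
    refine setIntegral_congr_fun (measurableSet_periodSquare a) fun x hx => ?_
    simp only [Function.comp_apply, torusSection_torusProj ha hx]
  simp_rw [hcoef, norm_mul, mul_pow]
  exact ((UnitAddTorus.hasSum_sq_mFourierCoeff (hF.toLp _)).summable.comp_injective
    (finTwoArrowEquiv ℤ).symm.injective).mul_left _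

/-! ### Density of trigonometric polynomials in `L¹` -/

theorem exists_mem_span_mFourier_integral_norm_sub_le {d : Type*} [Fintype d]
    {f : UnitAddTorus d → ℂ} (hf : Integrable f) {ε : ℝ} (hε : 0 < ε) :
    ∃ p ∈ Submodule.span ℂ (range (UnitAddTorus.mFourier (d := d))), ∫ θ, ‖f θ - p θ‖ ≤ ε := by
  obtain ⟨g, hfg, hg⟩ := hf.exists_boundedContinuous_integral_sub_le (half_pos hε)
  obtain ⟨p, hp, hgp⟩ := Metric.mem_closure_iff.1 (show g.toContinuousMap ∈ closure _ from
    UnitAddTorus.span_mFourier_closure_eq_top.ge Submodule.mem_top) _ (half_pos hε)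
  have hpi : Integrable p := p.continuous.integrable_of_hasCompactSupport
    (HasCompactSupport.of_compactSpace p)
  have hgp' : ∀ θ, ‖g θ - p θ‖ ≤ ε / 2 := fun θ => by
    rw [← dist_eq_norm]
    exact (ContinuousMap.dist_apply_le_dist (f := g.toContinuousMap) (g := p) θ).trans hgp.le
  refine ⟨p, hp, ?_⟩
  calc ∫ θ, ‖f θ - p θ‖
      ≤ ∫ θ, (‖f θ - g θ‖ + ‖g θ - p θ‖) := integral_mono (hf.sub hpi).norm
        ((hf.sub hg).norm.add (hg.sub hpi).norm) fun θ => norm_sub_le_norm_sub_add_norm_sub _ _ _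
    _ = (∫ θ, ‖f θ - g θ‖) + ∫ θ, ‖g θ - p θ‖ :=
        MeasureTheory.integral_add (hf.sub hg).norm (hg.sub hpi).norm
    _ ≤ ε / 2 + ∫ _ : UnitAddTorus d, ε / 2 :=
        add_le_add hfg (integral_mono (hg.sub hpi).norm (integrable_const _) hgp')
    _ = ε := by rw [MeasureTheory.integral_const, probReal_univ, one_smul, add_halves]

theorem comp_torusProj_mem_span {a : ℝ} {p : C(UnitAddTorus (Fin 2), ℂ)}
    (hp : p ∈ Submodule.span ℂ (range (UnitAddTorus.mFourier (d := Fin 2)))) :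
    p ∘ torusProj a ∈ Submodule.span ℂ (range (squareMonomial a)) := by
  induction hp using Submodule.span_induction with
  | mem p h =>
    obtain ⟨n, rfl⟩ := h
    exact Submodule.subset_span ⟨(n 0, n 1), funext fun x => (mFourier_torusProj a n x).symm⟩
  | zero => exact Submodule.zero_mem _
  | add p q _ _ hp hq => exact Submodule.add_mem _ hp hq
  | smul c p _ hp => exact Submodule.smul_mem _ c hp

theorem exists_mem_span_squareMonomial_integral_norm_sub_le {a : ℝ} (ha : 0 < a)
    {f : ℝ × ℝ → ℂ} (hf : IntegrableOn f (periodSquare a)) {ε : ℝ} (hε : 0 < ε) :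
    ∃ t ∈ Submodule.span ℂ (range (squareMonomial a)),
      ∫ x in periodSquare a, ‖f x - t x‖ ≤ ε := by
  have hF := memLp_one_iff_integrable.1
    (memLp_comp_torusSection ha (memLp_one_iff_integrable.2 hf))
  obtain ⟨p, hp, hfp⟩ := exists_mem_span_mFourier_integral_norm_sub_le hF
    (show 0 < ε / (4 * a ^ 2) by positivity)
  refine ⟨p ∘ torusProj a, comp_torusProj_mem_span hp, ?_⟩
  calc ∫ x in periodSquare a, ‖f x - p (torusProj a x)‖
      = ∫ x in periodSquare a, ‖f (torusSection a (torusProj a x)) - p (torusProj a x)‖ :=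
        setIntegral_congr_fun (measurableSet_periodSquare a)
          fun x hx => by simp only [torusSection_torusProj ha hx]
    _ = 4 * a ^ 2 * ∫ θ, ‖f (torusSection a θ) - p θ‖ := setIntegral_comp_torusProj ha
        (F := fun θ => ‖f (torusSection a θ) - p θ‖)
        (hF.aestronglyMeasurable.sub p.continuous.aestronglyMeasurable).norm
    _ ≤ ε := by rwa [le_div_iff₀' (by positivity)] at hfp

end Torus

/-! ### Pairing with the square partial sums -/

section Pairing

variable {X : Type*} [MeasurableSpace X] {ν : Measure X} {f t : X → ℂ} {C : ℝ}

theorem norm_integral_mul_sub_integral_mul_le {G : X → ℂ} (hf : Integrable f ν)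
    (ht : Integrable t ν) (hG : AEStronglyMeasurable G ν) (hC : ∀ᵐ x ∂ν, ‖G x‖ ≤ C) :
    ‖∫ x, f x * G x ∂ν - ∫ x, t x * G x ∂ν‖ ≤ C * ∫ x, ‖f x - t x‖ ∂ν := by
  rw [← MeasureTheory.integral_sub (hf.mul_bdd hG hC) (ht.mul_bdd hG hC),
    ← MeasureTheory.integral_const_mul]
  refine norm_integral_le_of_norm_le ((hf.sub ht).norm.const_mul C) (hC.mono fun x hx => ?_)
  rw [← sub_mul, norm_mul, mul_comm]
  exact mul_le_mul_of_nonneg_right hx (norm_nonneg _)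

theorem tendsto_integral_mul_of_approx {ι : Type*} {l : Filter ι} {G : ι → X → ℂ} {G₀ : X → ℂ}
    (hf : Integrable f ν) (hG : ∀ i, AEStronglyMeasurable (G i) ν)
    (hC : ∀ i, ∀ᵐ x ∂ν, ‖G i x‖ ≤ C) (hG₀ : AEStronglyMeasurable G₀ ν)
    (hC₀ : ∀ᵐ x ∂ν, ‖G₀ x‖ ≤ C)
    (happrox : ∀ ε > 0, ∃ t, Integrable t ν ∧ ∫ x, ‖f x - t x‖ ∂ν ≤ ε ∧
      Filter.Tendsto (fun i => ∫ x, t x * G i x ∂ν) l (nhds (∫ x, t x * G₀ x ∂ν))) :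
    Filter.Tendsto (fun i => ∫ x, f x * G i x ∂ν) l (nhds (∫ x, f x * G₀ x ∂ν)) := by
  rw [Metric.tendsto_nhds]
  intro ε hε
  obtain ⟨t, ht, hft, hlim⟩ := happrox (ε / (3 * (|C| + 1))) (by positivity)
  have hsmall : C * ∫ x, ‖f x - t x‖ ∂ν < ε / 3 := by
    calc C * ∫ x, ‖f x - t x‖ ∂ν ≤ |C| * (ε / (3 * (|C| + 1))) :=
          mul_le_mul (le_abs_self C) hft (by positivity) (abs_nonneg C)
      _ < (|C| + 1) * (ε / (3 * (|C| + 1))) := by gcongr; linarith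
      _ = ε / 3 := by field_simp
  filter_upwards [Metric.tendsto_nhds.1 hlim (ε / 3) (by positivity)] with i hi
  have hfi := norm_integral_mul_sub_integral_mul_le hf ht (hG i) (hC i)
  have hf₀ := norm_integral_mul_sub_integral_mul_le hf ht hG₀ hC₀
  rw [← dist_eq_norm] at hfi hf₀
  rw [dist_comm] at hf₀
  linarith [dist_triangle4 (∫ x, f x * G i x ∂ν) (∫ x, t x * G i x ∂ν) (∫ x, t x * G₀ x ∂ν)
    (∫ x, f x * G₀ x ∂ν)]

end Pairing

theorem periodSquare_ae_eq (a : ℝ) :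
    periodSquare a =ᵐ[volume] (Icc (-a) a ×ˢ Icc (-a) a : Set (ℝ × ℝ)) :=
  Measure.set_prod_ae_eq Ioc_ae_eq_Icc Ioc_ae_eq_Icc

theorem disk_ae_le_periodSquare {a : ℝ} (ha : 0 ≤ a) : disk a ≤ᵐ[volume] periodSquare a :=
  (disk_subset_Icc ha).eventuallyLE.trans_eq (periodSquare_ae_eq a).symm

/-- The conjugate Fourier–Zernike function `V_{nm}^a`, `n = |m| + 2l`, cut off outside
`disk a`. -/
noncomputable def zernikeWindow (a : ℝ) (m : ℤ) (l : ℕ) : ℝ × ℝ → ℂ :=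
  (disk a).indicator (conjZernike a m l)

section Window

variable {a : ℝ} (m : ℤ) (l : ℕ)

variable (a) in
theorem measurable_zernikeWindow : Measurable (zernikeWindow a m l) :=
  (continuous_conjZernike a m l).measurable.indicator (measurableSet_disk a)

theorem exists_norm_zernikeWindow_le (ha : 0 ≤ a) :
    ∃ C, ∀ x, ‖zernikeWindow a m l x‖ ≤ C := by
  obtain ⟨C, hC⟩ := (isBounded_disk ha).isCompact_closure.exists_bound_of_continuousOn
    (continuous_conjZernike a m l).continuousOn
  refine ⟨max C 0, fun x => ?_⟩
  by_cases hx : x ∈ disk a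
  · rw [zernikeWindow, indicator_of_mem hx]
    exact (hC x (subset_closure hx)).trans (le_max_left C 0)
  · rw [zernikeWindow, indicator_of_notMem hx, norm_zero]
    exact le_max_right C 0

theorem setIntegral_mul_zernikeWindow (ha : 0 ≤ a) (f : ℝ × ℝ → ℂ) :
    ∫ x in periodSquare a, f x * zernikeWindow a m l x
      = ∫ z in disk a, f z * conjZernike a m l z := by
  have hwindow : (fun x => f x * zernikeWindow a m l x) =
      (disk a).indicator fun z => f z * conjZernike a m l z := by
    funext x
    rw [zernikeWindow, Set.indicator_mul_right]
  rw [hwindow, setIntegral_indicator (measurableSet_disk a)]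
  exact setIntegral_congr_set (Filter.inter_eventuallyEq_right.2 (disk_ae_le_periodSquare ha))

theorem setIntegral_squareMonomial_mul_zernikeWindow (ha : 0 < a) (k : ℤ × ℤ) :
    ∫ x in periodSquare a, squareMonomial a k x * zernikeWindow a m l x
      = 4 * a ^ 2 * convFactor a k (m.natAbs + 2 * l) m := by
  rw [setIntegral_mul_zernikeWindow m l ha.le, setIntegral_squareMonomial_mul_conjZernike ha]

end Window

theorem monotone_latticeSquare : Monotone latticeSquare := fun M N hMN =>
  Finset.product_subset_product (Finset.Icc_subset_Icc (by lia) (by lia))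
    (Finset.Icc_subset_Icc (by lia) (by lia))

theorem exists_mem_latticeSquare (k : ℤ × ℤ) : ∃ N, k ∈ latticeSquare N := by
  refine ⟨k.1.natAbs + k.2.natAbs, ?_⟩
  simp only [latticeSquare, Finset.mem_product, Finset.mem_Icc]
  lia

theorem tendsto_latticeSquare : Filter.Tendsto latticeSquare Filter.atTop Filter.atTop :=
  Filter.tendsto_atTop_finset_of_monotone monotone_latticeSquare exists_mem_latticeSquare

theorem continuous_zernikePartialSum (a : ℝ) (n : ℕ) (m : ℤ) (N : ℕ) :
    Continuous (zernikePartialSum a n m N) :=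
  continuous_finsetSum _ fun k _ => continuous_const.mul (continuous_squareMonomial a (-k))

theorem setIntegral_mul_zernikePartialSum {a : ℝ} {f : ℝ × ℝ → ℂ}
    (hf : IntegrableOn f (periodSquare a)) (n : ℕ) (m : ℤ) (N : ℕ) :
    ∫ x in periodSquare a, f x * zernikePartialSum a n m N x = ∑ k ∈ latticeSquare N,
      convFactor a k n m * ∫ x in periodSquare a, f x * squareMonomial a (-k) x := by
  simp_rw [zernikePartialSum, Finset.mul_sum, mul_left_comm (f _)]
  rw [MeasureTheory.integral_finsetSum _ fun k _ => (hf.mul_bdd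
    (continuous_squareMonomial a (-k)).aestronglyMeasurable
    (.of_forall fun x => (norm_squareMonomial a (-k) x).le)).const_mul _]
  simp_rw [MeasureTheory.integral_const_mul]

theorem continuous_of_mem_span_squareMonomial {a : ℝ} {t : ℝ × ℝ → ℂ}
    (ht : t ∈ Submodule.span ℂ (range (squareMonomial a))) : Continuous t := by
  induction ht using Submodule.span_induction with
  | mem t h => obtain ⟨k, rfl⟩ := h; exact continuous_squareMonomial a k
  | zero => exact continuous_const
  | add t u _ _ ht hu => exact ht.add hu
  | smul c t _ ht => exact ht.const_smul c

section Limits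

variable {a : ℝ} (ha : 0 < a) (m : ℤ) (l : ℕ)
include ha

theorem tendsto_setIntegral_squareMonomial_mul_zernikePartialSum (k : ℤ × ℤ) :
    Filter.Tendsto (fun N => ∫ x in periodSquare a,
        squareMonomial a k x * zernikePartialSum a (m.natAbs + 2 * l) m N x) Filter.atTop
      (nhds (∫ x in periodSquare a, squareMonomial a k x * zernikeWindow a m l x)) := by
  refine tendsto_nhds_of_eventually_eq ((tendsto_latticeSquare.eventually
    (Filter.eventually_ge_atTop {k})).mono fun N hN => ?_)
  rw [setIntegral_mul_zernikePartialSum (integrableOn_of_isBounded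
    (continuous_squareMonomial a k) (isBounded_periodSquare a)),
    setIntegral_squareMonomial_mul_zernikeWindow m l ha]
  simp_rw [setIntegral_squareMonomial_mul_neg ha, mul_ite, mul_zero]
  rw [Finset.sum_ite_eq', if_pos (Finset.singleton_subset_iff.1 hN), mul_comm]

theorem tendsto_setIntegral_mul_zernikePartialSum_of_mem_span {t : ℝ × ℝ → ℂ}
    (ht : t ∈ Submodule.span ℂ (range (squareMonomial a))) :
    Filter.Tendsto (fun N => ∫ x in periodSquare a,
        t x * zernikePartialSum a (m.natAbs + 2 * l) m N x) Filter.atTop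
      (nhds (∫ x in periodSquare a, t x * zernikeWindow a m l x)) := by
  obtain ⟨C, hC⟩ := exists_norm_zernikeWindow_le m l ha.le
  have hsum : ∀ {u : ℝ × ℝ → ℂ}, u ∈ Submodule.span ℂ (range (squareMonomial a)) → ∀ N,
      IntegrableOn (fun x => u x * zernikePartialSum a (m.natAbs + 2 * l) m N x)
        (periodSquare a) := fun hu N =>
    integrableOn_of_isBounded ((continuous_of_mem_span_squareMonomial hu).mul
      (continuous_zernikePartialSum a _ m N)) (isBounded_periodSquare a)
  have hwindow : ∀ {u : ℝ × ℝ → ℂ}, u ∈ Submodule.span ℂ (range (squareMonomial a)) →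
      IntegrableOn (fun x => u x * zernikeWindow a m l x) (periodSquare a) := fun hu =>
    (integrableOn_of_isBounded (continuous_of_mem_span_squareMonomial hu)
      (isBounded_periodSquare a)).mul_bdd (measurable_zernikeWindow a m l).aestronglyMeasurable
      (.of_forall hC)
  induction ht using Submodule.span_induction with
  | mem t h =>
    obtain ⟨k, rfl⟩ := h
    exact tendsto_setIntegral_squareMonomial_mul_zernikePartialSum ha m l k
  | zero => simp only [Pi.zero_apply, zero_mul, integral_zero, tendsto_const_nhds_iff]
  | add t u ht' hu' ht hu =>
    simp only [Pi.add_apply, add_mul]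
    simp_rw [MeasureTheory.integral_add (hsum ht' _) (hsum hu' _)]
    rw [MeasureTheory.integral_add (hwindow ht') (hwindow hu')]
    exact ht.add hu
  | smul c t _ ht =>
    simp only [Pi.smul_apply, smul_eq_mul, mul_assoc, MeasureTheory.integral_const_mul]
    exact ht.const_mul c

theorem tendsto_setIntegral_mul_zernikePartialSum {f : ℝ × ℝ → ℂ}
    (hf : IntegrableOn f (periodSquare a)) :
    Filter.Tendsto (fun N => ∫ x in periodSquare a,
        f x * zernikePartialSum a (m.natAbs + 2 * l) m N x) Filter.atTop
      (nhds (zernikeCoeff a (m.natAbs + 2 * l) m f)) := by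
  obtain ⟨C, hC⟩ := exists_norm_zernikePartialSum_le ha m l
  obtain ⟨C', hC'⟩ := exists_norm_zernikeWindow_le m l ha.le
  rw [zernikeCoeff_eq_setIntegral ha.le m l (hf.mono_set_ae (disk_ae_le_periodSquare ha.le)),
    ← setIntegral_mul_zernikeWindow m l ha.le]
  refine tendsto_integral_mul_of_approx (C := max C C') hf
    (fun N => (continuous_zernikePartialSum a _ m N).aestronglyMeasurable)
    (fun N => ae_restrict_of_forall_mem (measurableSet_periodSquare a) fun x hx =>
      (hC N x (abs_le.2 ⟨hx.1.1.le, hx.1.2⟩) (abs_le.2 ⟨hx.2.1.le, hx.2.2⟩)).trans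
        (le_max_left C C'))
    (measurable_zernikeWindow a m l).aestronglyMeasurable
    (.of_forall fun x => (hC' x).trans (le_max_right C C')) fun ε hε => ?_
  obtain ⟨t, ht, hft⟩ := exists_mem_span_squareMonomial_integral_norm_sub_le ha hf hε
  exact ⟨t, integrableOn_of_isBounded (continuous_of_mem_span_squareMonomial ht)
    (isBounded_periodSquare a), hft,
    tendsto_setIntegral_mul_zernikePartialSum_of_mem_span ha m l ht⟩

/-! ### Absolute convergence -/

theorem summable_sq_norm_convFactor :
    Summable fun k : ℤ × ℤ => ‖convFactor a k (m.natAbs + 2 * l) m‖ ^ 2 := by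
  obtain ⟨C, hC⟩ := exists_norm_zernikeWindow_le m l ha.le
  have : IsFiniteMeasure (volume.restrict (periodSquare a)) :=
    ⟨by rw [Measure.restrict_apply_univ]; exact (isBounded_periodSquare a).measure_lt_top⟩
  have hbessel := summable_sq_norm_setIntegral_mul_squareMonomial ha
    (MemLp.of_bound (measurable_zernikeWindow a m l).aestronglyMeasurable C (.of_forall hC))
  simp_rw [mul_comm (zernikeWindow a m l _), setIntegral_squareMonomial_mul_zernikeWindow m l ha,
    norm_mul _ (convFactor _ _ _ _), mul_pow] at hbessel
  have hne : (4 * a ^ 2 : ℂ) ≠ 0 :=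
    mul_ne_zero (by norm_num) (pow_ne_zero 2 (Complex.ofReal_ne_zero.2 ha.ne'))
  exact (Equiv.neg (ℤ × ℤ)).summable_iff.1 ((summable_mul_left_iff
    (pow_ne_zero 2 (norm_ne_zero_iff.2 hne))).1 hbessel)

theorem summable_convFactor_mul {f : ℝ × ℝ → ℂ}
    (hf : MemLp f 2 (volume.restrict (periodSquare a))) :
    Summable fun k : ℤ × ℤ => convFactor a k (m.natAbs + 2 * l) m *
      ∫ x in periodSquare a, f x * squareMonomial a (-k) x := by
  refine .of_norm_bounded ((summable_sq_norm_convFactor ha m l).add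
    (summable_sq_norm_setIntegral_mul_squareMonomial ha hf)) fun k => ?_
  rw [norm_mul]
  nlinarith [two_mul_le_add_sq ‖convFactor a k (m.natAbs + 2 * l) m‖
    ‖∫ x in periodSquare a, f x * squareMonomial a (-k) x‖,
    mul_nonneg (norm_nonneg (convFactor a k (m.natAbs + 2 * l) m))
      (norm_nonneg (∫ x in periodSquare a, f x * squareMonomial a (-k) x))]

end Limits

/-! ### Convolution -/

section Convolution

open scoped Pointwise

variable {f₁ f₂ : ℝ × ℝ → ℂ} {S T : Set (ℝ × ℝ)}

theorem planeConv_eq_zero_of_notMem_add (hf₁ : ∀ᵐ x, x ∉ S → f₁ x = 0)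
    (hf₂ : ∀ᵐ x, x ∉ T → f₂ x = 0) {x : ℝ × ℝ} (hx : x ∉ S + T) : planeConv f₁ f₂ x = 0 := by
  rw [planeConv, convolution_def]
  refine integral_eq_zero_of_ae ?_
  filter_upwards [hf₁,
    (quasiMeasurePreserving_sub_left_of_right_invariant volume x).ae hf₂] with t ht₁ ht₂
  by_cases ht : t ∈ S
  · have hxt : x - t ∉ T := fun h => hx (mem_add.2 ⟨t, ht, x - t, h, add_sub_cancel t x⟩)
    simp only [ContinuousLinearMap.mul_apply', ht₂ hxt, mul_zero, Pi.zero_apply]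
  · simp only [ContinuousLinearMap.mul_apply', ht₁ ht, zero_mul, Pi.zero_apply]

theorem squareMonomial_mul_sub (a : ℝ) (k : ℤ × ℤ) (x t : ℝ × ℝ) :
    squareMonomial a k t * squareMonomial a k (x - t) = squareMonomial a k x := by
  simp only [squareMonomial, ← Complex.exp_add, Prod.fst_sub, Prod.snd_sub]
  push_cast
  ring_nf

theorem integrable_mul_squareMonomial {f : ℝ × ℝ → ℂ} {ν : Measure (ℝ × ℝ)}
    (hf : Integrable f ν) (a : ℝ) (k : ℤ × ℤ) :
    Integrable (fun x => f x * squareMonomial a k x) ν :=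
  hf.mul_bdd (continuous_squareMonomial a k).aestronglyMeasurable
    (.of_forall fun x => (norm_squareMonomial a k x).le)

theorem integral_planeConv_mul_squareMonomial (hf₁ : Integrable f₁) (hf₂ : Integrable f₂)
    (a : ℝ) (k : ℤ × ℤ) :
    ∫ x, planeConv f₁ f₂ x * squareMonomial a k x =
      (∫ x, f₁ x * squareMonomial a k x) * ∫ x, f₂ x * squareMonomial a k x := by
  have hconv := integral_convolution (ContinuousLinearMap.mul ℝ ℂ)
    (integrable_mul_squareMonomial hf₁ a k) (integrable_mul_squareMonomial hf₂ a k)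
  have hmul : ∀ x t, f₁ t * squareMonomial a k t * (f₂ (x - t) * squareMonomial a k (x - t)) =
      f₁ t * f₂ (x - t) * squareMonomial a k x := fun x t => by
    rw [mul_mul_mul_comm, squareMonomial_mul_sub]
  rw [ContinuousLinearMap.mul_apply'] at hconv
  simp_rw [← hconv, planeConv, convolution_def, ContinuousLinearMap.mul_apply', hmul,
    MeasureTheory.integral_mul_const]

theorem squareFourierCoeff_eq_setIntegral {a : ℝ} (ha : 0 ≤ a) {f : ℝ × ℝ → ℂ}
    (hf : IntegrableOn f (periodSquare a)) (k : ℤ × ℤ) :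
    squareFourierCoeff a f k = ∫ x in periodSquare a, f x * squareMonomial a (-k) x := by
  have hint := integrable_mul_squareMonomial hf a (-k)
  rw [periodSquare, Measure.volume_eq_prod, ← Measure.prod_restrict] at hint ⊢
  rw [integral_prod_symm _ hint, squareFourierCoeff, integral_of_le (by linarith)]
  simp_rw [integral_of_le (show -a ≤ a by linarith), squareMonomial]
  push_cast [Prod.fst_neg, Prod.snd_neg]
  ring_nf

theorem setIntegral_periodSquare_mul_eq_integral {a : ℝ} {f : ℝ × ℝ → ℂ}
    (hS : S ⊆ Icc (-a) a ×ˢ Icc (-a) a) (hf : ∀ᵐ x, x ∉ S → f x = 0) (g : ℝ × ℝ → ℂ) :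
    ∫ x in periodSquare a, f x * g x = ∫ x, f x * g x := by
  refine setIntegral_eq_integral_of_ae_compl_eq_zero ?_
  filter_upwards [hf, (periodSquare_ae_eq a).symm.le] with x hx hxQ hxQ'
  rw [hx fun h => hxQ' (hxQ (hS h)), zero_mul]

theorem setIntegral_planeConv_mul_squareMonomial {a : ℝ} (ha : 0 ≤ a)
    (hS : S ⊆ Icc (-a) a ×ˢ Icc (-a) a) (hT : T ⊆ Icc (-a) a ×ˢ Icc (-a) a)
    (hST : S + T ⊆ Icc (-a) a ×ˢ Icc (-a) a) (hf₁ : Integrable f₁) (hf₂ : Integrable f₂)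
    (hs₁ : ∀ᵐ x, x ∉ S → f₁ x = 0) (hs₂ : ∀ᵐ x, x ∉ T → f₂ x = 0) (k : ℤ × ℤ) :
    ∫ x in periodSquare a, planeConv f₁ f₂ x * squareMonomial a (-k) x =
      squareFourierCoeff a f₁ k * squareFourierCoeff a f₂ k := by
  rw [squareFourierCoeff_eq_setIntegral ha hf₁.integrableOn,
    squareFourierCoeff_eq_setIntegral ha hf₂.integrableOn,
    setIntegral_periodSquare_mul_eq_integral hS hs₁,
    setIntegral_periodSquare_mul_eq_integral hT hs₂,
    setIntegral_periodSquare_mul_eq_integral hST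
      (.of_forall fun _ => planeConv_eq_zero_of_notMem_add hs₁ hs₂),
    integral_planeConv_mul_squareMonomial hf₁ hf₂]

theorem disk_subset_Icc_of_le {ρ a : ℝ} (hρ : 0 ≤ ρ) (h : ρ ≤ a) :
    disk ρ ⊆ Icc (-a) a ×ˢ Icc (-a) a :=
  (disk_subset_Icc hρ).trans
    (prod_mono (Icc_subset_Icc (neg_le_neg h) h) (Icc_subset_Icc (neg_le_neg h) h))

theorem disk_add_disk_subset_Icc {ρ σ : ℝ} (hρ : 0 ≤ ρ) (hσ : 0 ≤ σ) :
    disk ρ + disk σ ⊆ Icc (-(ρ + σ)) (ρ + σ) ×ˢ Icc (-(ρ + σ)) (ρ + σ) := by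
  refine (add_subset_add (disk_subset_Icc hρ) (disk_subset_Icc hσ)).trans ?_
  rw [prod_add_prod_comm, neg_add]
  exact prod_mono (Icc_add_Icc_subset _ _ _ _) (Icc_add_Icc_subset _ _ _ _)

end Convolution

theorem exists_eq_natAbs_add_two_mul {n : ℕ} {m : ℤ} (hmn : m.natAbs ≤ n)
    (hpar : n ≡ m.natAbs [MOD 2]) : ∃ l, n = m.natAbs + 2 * l := by
  obtain ⟨l, hl⟩ := (Nat.modEq_iff_dvd' hmn).1 hpar.symm
  exact ⟨l, by lia⟩

open scoped Pointwise in
theorem mainTheorem1_general {a : ℝ} (ha : 0 < a) {S T : Set (ℝ × ℝ)}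
    (hS : S ⊆ Icc (-a) a ×ˢ Icc (-a) a) (hT : T ⊆ Icc (-a) a ×ˢ Icc (-a) a)
    (hST : S + T ⊆ Icc (-a) a ×ˢ Icc (-a) a) {f₁ f₂ : ℝ × ℝ → ℂ}
    (hf₁ : Integrable f₁) (hf₂ : Integrable f₂)
    (hs₁ : ∀ᵐ x, x ∉ S → f₁ x = 0) (hs₂ : ∀ᵐ x, x ∉ T → f₂ x = 0)
    {n : ℕ} {m : ℤ} (hmn : m.natAbs ≤ n) (hpar : n ≡ m.natAbs [MOD 2]) :
    Filter.Tendsto (fun N : ℕ => ∑ k ∈ latticeSquare N,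
        convFactor a k n m * squareFourierCoeff a f₁ k * squareFourierCoeff a f₂ k)
      Filter.atTop (nhds (zernikeCoeff a n m (planeConv f₁ f₂))) ∧
    (MemLp (planeConv f₁ f₂) 2 →
      HasSum (fun k : ℤ × ℤ =>
          convFactor a k n m * squareFourierCoeff a f₁ k * squareFourierCoeff a f₂ k)
        (zernikeCoeff a n m (planeConv f₁ f₂))) := by
  obtain ⟨l, rfl⟩ := exists_eq_natAbs_add_two_mul hmn hpar
  have hint : IntegrableOn (planeConv f₁ f₂) (periodSquare a) :=
    (hf₁.integrable_convolution _ hf₂).integrableOn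
  have hlim := tendsto_setIntegral_mul_zernikePartialSum ha m l hint
  simp_rw [setIntegral_mul_zernikePartialSum hint, mul_assoc,
    setIntegral_planeConv_mul_squareMonomial ha.le hS hT hST hf₁ hf₂ hs₁ hs₂] at hlim ⊢
  refine ⟨hlim, fun hL2 => ?_⟩
  have hsum := summable_convFactor_mul ha m l (hL2.restrict (periodSquare a))
  simp_rw [setIntegral_planeConv_mul_squareMonomial ha.le hS hT hST hf₁ hf₂ hs₁ hs₂] at hsum
  rw [tendsto_nhds_unique hlim (hsum.hasSum.comp tendsto_latticeSquare)]
  exact hsum.hasSum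

/-- For integrable `f₁, f₂` the series over `ℤ²` need not converge absolutely: it is the limit of its
square partial sums. It converges absolutely as soon as `f₁ ∗ f₂` is square integrable. -/
theorem mainTheorem1 (a : ℝ) (ha : 0 < a) (f₁ f₂ : ℝ × ℝ → ℂ)
    (hf₁ : MeasureTheory.Integrable f₁ MeasureTheory.volume)
    (hf₂ : MeasureTheory.Integrable f₂ MeasureTheory.volume)
    (hs₁ : ∀ᵐ x ∂(MeasureTheory.volume : MeasureTheory.Measure (ℝ × ℝ)),
      x ∉ disk (a / 2) → f₁ x = 0)
    (hs₂ : ∀ᵐ x ∂(MeasureTheory.volume : MeasureTheory.Measure (ℝ × ℝ)),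
      x ∉ disk (a / 2) → f₂ x = 0)
    (n : ℕ) (m : ℤ) (hmn : m.natAbs ≤ n) (hpar : n ≡ m.natAbs [MOD 2]) :
    Filter.Tendsto
      (fun N : ℕ => ∑ k ∈ latticeSquare N,
        convFactor a k n m * squareFourierCoeff a f₁ k * squareFourierCoeff a f₂ k)
      Filter.atTop (nhds (zernikeCoeff a n m (planeConv f₁ f₂))) ∧
    (MeasureTheory.MemLp (planeConv f₁ f₂) 2 MeasureTheory.volume →
      HasSum
        (fun k : ℤ × ℤ =>
          convFactor a k n m * squareFourierCoeff a f₁ k * squareFourierCoeff a f₂ k)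
        (zernikeCoeff a n m (planeConv f₁ f₂))) :=
  have hr : 0 ≤ a / 2 := by positivity
  have hdisk := disk_subset_Icc_of_le hr (half_le_self ha.le)
  mainTheorem1_general ha hdisk hdisk
    (by simpa only [add_halves] using disk_add_disk_subset_Icc hr hr) hf₁ hf₂ hs₁ hs₂ hmn hpar
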